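/- **Setting.** There are $n\ge 1$ clients $i\in\mathcal I=\{1,\dots,n\}$ with data distributions $\mathcal D_i$ (probability measures on a measurable space $\mathcal Z$), jointly measurable sample functions $f_i(w,z),g_i(w,z)\in\mathbb R$ and jointly measurable stochastic gradient oracles $\nabla f_i(w,z),\nabla g_i(w,z)\in\mathbb R^d$. Let $\Theta\subseteq\mathbb R^d$ be a convex Borel set, $f_i(w)=\mathbb E_{z\sim\mathcal D_i}[f_i(w,z)]$, $g_i(w)=\mathbb E_{z\sim\mathcal D_i}[g_i(w,z)]$, $F=\max_i f_i$, $G=\max_i g_i$, and let $w^*\in\Theta$ minimize $F$ over $\{w\in\Theta: G(w)\le 0\}$. **Assumptions.** Let $L,D,\sigma_\zeta,\sigma_g>0$. For all $i$: 1. $f_i$ and $g_i$ are convex on $\Theta$. 2. $|f_i(w_1)-f_i(w_2)|\le L\|w_1-w_2\|$ and $|g_i(w_1)-g_i(w_2)|\le L\|w_1-w_2\|$ for $w_1,w_2\in\Theta$. 3. $\|w_1-w_2\|\le D$ for $w_1,w_2\in\Theta$. 4. For $w\in\Theta$, $f_i(w,\cdot)$ and $g_i(w,\cdot)$ are $\mathcal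 D_i$-integrable, $\mathbb E_{z\sim\mathcal D_i}[\exp((f_i(w,z)-f_i(w))^2/\sigma_\zeta^2)]\le 2$, and likewise for $g_i$. 5. For $w\in\Theta$, $\nabla f_i(w,\cdot)$ is $\mathcal D_i$-integrable, its mean $\nabla f_i(w):=\mathbb E_{z\sim\mathcal D_i}[\nabla f_i(w,z)]$ is a subgradient at $w$ of $f_i$ on $\Theta$, $\mathbb E_{z\sim\mathcal D_i}[\exp(\|\nabla f_i(w,z)-\nabla f_i(w)\|^2/\sigma_g^2)]\le 2$, and likewise for $g_i$. At points $w\in\Theta$ that are not interior to $\Theta$, moreover $\|\nabla f_i(w)\|\le L$ and $\|\nabla g_i(w)\|\le L$. **Algorithm (full participation).** Let $K,E,B_\zeta,B_g\ge1$ be integers and $w_0\in\Theta$. In round $k=0,\dots,K-1$, each client $i$ draws samples $\xi_{k,s}^{(i)}\sim\mathcal D_i$ ($1\le s\le B_\zeta$) and forms the vectors $\hat f_k,\hat g_k\in\mathbb R^n$ with entries $\hat f_{k,i}=\frac1{B_\zeta}\sum_s f_i(w_k,\xi_{k,s}^{(i)})$ and $\hat g_{k,i}=\frac1{B_\zeta}\sum_s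 g_i(w_k,\xi_{k,s}^{(i)})$. Put $p_k=\mathrm{softmax}(\alpha\hat f_k)$, $q_k=\mathrm{softmax}(\alpha\hat g_k)$, where $\mathrm{softmax}(v)_i=e^{v_i}/\sum_j e^{v_j}$. The round is *accepted* if $\langle q_k,\hat g_k\rangle\le\epsilon/2$; put $(r_k,h_i)=(p_k,f_i)$ if it is accepted and $(r_k,h_i)=(q_k,g_i)$ otherwise. Each client sets $w_{k,0}^{(i)}=w_k$ and, for $\tau=0,\dots,E-1$, draws $\zeta_{k,\tau,s}^{(i)}\sim\mathcal D_i$ ($1\le s\le B_g$) and sets $w_{k,\tau+1}^{(i)}=w_{k,\tau}^{(i)}-\gamma\frac1{B_g}\sum_s\nabla h_i(w_{k,\tau}^{(i)},\zeta_{k,\tau,s}^{(i)})$. Then $w_{k+1}=w_k-\eta\sum_i r_{k,i}\,\dfrac{w_{k,0}^{(i)}-w_{k,E}^{(i)}}{\gamma E}$. All samples are mutually independent. The output $\overline w_K$ is the average of $w_k$ over the set $\mathcal S$ of accepted rounds. **Theorem.** Let $\delta\in(0,1)$, $\bar\sigma_g^2=\dfrac{\sigma_g^2/B_g}{L^2E}$,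 $\eta=\dfrac{D}{L\sqrt{8K}}$, $\gamma=\dfrac{D}{LE\sqrt{8K}}$, $$\epsilon'=\frac{DL}{\sqrt{K/32}}\Big[1+2\bar\sigma_g^2\Big(3+\frac{8\ln(8/\delta)}{K}\Big)+\bar\sigma_g\sqrt{8\ln(8/\delta)}\Big(1+\frac{E}{\sqrt{6K}}\Big)\Big],\qquad \epsilon=\epsilon'+4\sigma_\zeta\sqrt{\frac{2\ln(12Kn/\delta)}{B_\zeta}},$$ and $\alpha\ge 2\ln n/\epsilon'$. Then, with probability at least $1-\delta$, the following holds: if all points $w_{k,\tau}^{(i)}$ ($0\le k<K$, $i\in\mathcal I$, $0\le\tau<E$) at which the oracles are evaluated lie in $\Theta$, then $\mathcal S\neq\emptyset$, $\overline w_K\in\Theta$, and $$F(\overline w_K)-F(w^*)\le\epsilon,\qquad G(\overline w_K)\le\epsilon .$$ -/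

import Mathlib

open MeasureTheory ProbabilityTheory

noncomputable section

namespace SwitchingGradient

/-- The parameter space is a subset of `ℝ^d` with its Euclidean norm. -/
abbrev Vec (d : ℕ) : Type := EuclideanSpace ℝ (Fin d)

/-- Data of a federated constrained minimax problem with `n` clients: the local data
distributions, the sample objectives `f_i(w, z)`, the sample constraints `g_i(w, z)`, and the
stochastic gradient oracles `∇f_i(w, z)`, `∇g_i(w, z)`. -/
structure Problem (n d : ℕ) (Z : Type*) [MeasurableSpace Z] where
  dist : Fin n → Measure Z
  f : Fin n → Vec d → Z → ℝ
  g : Fin n → Vec d → Z → ℝ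
  gradf : Fin n → Vec d → Z → Vec d
  gradg : Fin n → Vec d → Z → Vec d

/-- The local expectations `h_i(w) = E_{z ∼ D_i} [h_i(w, z)]`, for real-valued or vector-valued
`h`. -/
def mean {n d : ℕ} {Z V : Type*} [MeasurableSpace Z] [NormedAddCommGroup V] [NormedSpace ℝ V]
    (P : Fin n → Measure Z) (h : Fin n → Vec d → Z → V) (i : Fin n) (w : Vec d) : V :=
  ∫ z, h i w z ∂(P i)

/-- The worst client value `max_i h_i(w)`. -/
def worst {n d : ℕ} [NeZero n] (h : Fin n → Vec d → ℝ) (w : Vec d) : ℝ :=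
  Finset.univ.sup' Finset.univ_nonempty fun i => h i w

/-- `F(w) = max_i f_i(w)`. -/
def Problem.F {n d : ℕ} [NeZero n] {Z : Type*} [MeasurableSpace Z] (p : Problem n d Z) :
    Vec d → ℝ :=
  worst (mean p.dist p.f)

/-- `G(w) = max_i g_i(w)`. -/
def Problem.G {n d : ℕ} [NeZero n] {Z : Type*} [MeasurableSpace Z] (p : Problem n d Z) :
    Vec d → ℝ :=
  worst (mean p.dist p.g)

/-- `w` minimizes `F` over `Θ` subject to `G ≤ 0`. -/
def Problem.IsOptimal {n d : ℕ} [NeZero n] {Z : Type*} [MeasurableSpace Z] (p : Problem n d Z)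
    (Θ : Set (Vec d)) (w : Vec d) : Prop :=
  w ∈ Θ ∧ p.G w ≤ 0 ∧ ∀ w' ∈ Θ, p.G w' ≤ 0 → p.F w ≤ p.F w'

/-! ### Assumptions on the problem -/

/-- All sample functions and oracles are jointly measurable. -/
def Problem.IsMeasurable {n d : ℕ} {Z : Type*} [MeasurableSpace Z] (p : Problem n d Z) : Prop :=
  ∀ i, Measurable (fun x : Vec d × Z => p.f i x.1 x.2) ∧
    Measurable (fun x : Vec d × Z => p.g i x.1 x.2) ∧
    Measurable (fun x : Vec d × Z => p.gradf i x.1 x.2) ∧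
    Measurable (fun x : Vec d × Z => p.gradg i x.1 x.2)

/-- `v` is a subgradient at `w` of the function `h` on `Θ`. -/
def IsSubgradientOn {d : ℕ} (Θ : Set (Vec d)) (h : Vec d → ℝ) (w v : Vec d) : Prop :=
  ∀ w' ∈ Θ, h w + inner ℝ v (w' - w) ≤ h w'

/-- `|h_i(w₁) - h_i(w₂)| ≤ L ‖w₁ - w₂‖` on `Θ` for every client. -/
def IsLipschitzFamily {n d : ℕ} (Θ : Set (Vec d)) (L : ℝ) (h : Fin n → Vec d → ℝ) : Prop :=
  ∀ i, ∀ w₁ ∈ Θ, ∀ w₂ ∈ Θ, |h i w₁ - h i w₂| ≤ L * ‖w₁ - w₂‖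

/-- At the points of `Θ` that are not interior, where a subgradient of an `L`-Lipschitz function
on `Θ` is not determined up to norm `L` by the function, the chosen subgradients have norm at
most `L`. -/
def IsBoundedOffInterior {n d : ℕ} (Θ : Set (Vec d)) (L : ℝ) (v : Fin n → Vec d → Vec d) : Prop :=
  ∀ i, ∀ w ∈ Θ \ interior Θ, ‖v i w‖ ≤ L

/-- The sample values `h_i(w, z)` are integrable, and their deviation from the mean is
sub-Gaussian: `E exp((h_i(w, z) - h_i(w))² / σ²) ≤ 2`. -/
def SubGaussianEstimates {n d : ℕ} {Z : Type*} [MeasurableSpace Z] (P : Fin n → Measure Z)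
    (Θ : Set (Vec d)) (σ : ℝ) (h : Fin n → Vec d → Z → ℝ) : Prop :=
  ∀ i, ∀ w ∈ Θ, Integrable (h i w) (P i) ∧
    ∫⁻ z, ENNReal.ofReal (Real.exp ((h i w z - mean P h i w) ^ 2 / σ ^ 2)) ∂(P i) ≤ 2

/-- The stochastic gradients `v_i(w, z)` are integrable, their mean is a subgradient at `w` of
the expected function `h_i`, and their deviation from the mean is sub-Gaussian:
`E exp(‖v_i(w, z) - v_i(w)‖² / σ²) ≤ 2`. -/
def SubGaussianGradients {n d : ℕ} {Z : Type*} [MeasurableSpace Z] (P : Fin n → Measure Z)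
    (Θ : Set (Vec d)) (σ : ℝ) (h : Fin n → Vec d → Z → ℝ) (v : Fin n → Vec d → Z → Vec d) :
    Prop :=
  ∀ i, ∀ w ∈ Θ, Integrable (v i w) (P i) ∧
    IsSubgradientOn Θ (mean P h i) w (mean P v i w) ∧
    ∫⁻ z, ENNReal.ofReal (Real.exp (‖v i w z - mean P v i w‖ ^ 2 / σ ^ 2)) ∂(P i) ≤ 2

/-! ### The algorithm -/

/-- Inputs of the algorithm: global and local step sizes, tolerance, softmax parameter, number of
local steps. -/
structure Params where
  η : ℝ
  γ : ℝ
  ε : ℝ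
  α : ℝ
  E : ℕ

/-- All data samples: `ξ k i s` is the `s`-th sample of client `i` in round `k` for function
values, `ζ k i τ s` the `s`-th sample of client `i` in local step `τ` of round `k` for gradients.
Only finitely many rounds and local steps are ever used. -/
structure Samples (n Bv Bg : ℕ) (Z : Type*) where
  ξ : ℕ → Fin n → Fin Bv → Z
  ζ : ℕ → Fin n → ℕ → Fin Bg → Z

/-- The batch average `(1/B) ∑_s h(w, x_s)`. -/
def batchMean {d B : ℕ} {Z V : Type*} [AddCommGroup V] [Module ℝ V]
    (h : Vec d → Z → V) (w : Vec d) (x : Fin B → Z) : V :=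
  (B : ℝ)⁻¹ • ∑ s, h w (x s)

/-- `softmax(v)_i = exp(v_i) / ∑_j exp(v_j)`. -/
def softmax {n : ℕ} (v : Fin n → ℝ) (i : Fin n) : ℝ :=
  Real.exp (v i) / ∑ j, Real.exp (v j)

/-- Local parameters after `τ` local gradient steps with step size `γ`, started at `w`. -/
def localIter {d Bg : ℕ} {Z : Type*} (v : Vec d → Z → Vec d) (γ : ℝ) (w : Vec d)
    (x : ℕ → Fin Bg → Z) : ℕ → Vec d
  | 0 => w
  | τ + 1 => localIter v γ w x τ - γ • batchMean v (localIter v γ w x τ) (x τ)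

section Algorithm

variable {n d Bv Bg : ℕ} {Z : Type*} [MeasurableSpace Z]

/-- The batch estimates `f_i(w, ξ^{(i)})` of the objectives. -/
def estF (p : Problem n d Z) (w : Vec d) (ξ : Fin n → Fin Bv → Z) (i : Fin n) : ℝ :=
  batchMean (p.f i) w (ξ i)

/-- The batch estimates `g_i(w, ξ^{(i)})` of the constraints. -/
def estG (p : Problem n d Z) (w : Vec d) (ξ : Fin n → Fin Bv → Z) (i : Fin n) : ℝ :=
  batchMean (p.g i) w (ξ i)

/-- The switching criterion `⟨softmax(α g(w, ξ)), g(w, ξ)⟩ ≤ ε / 2`. -/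
def Accepts (p : Problem n d Z) (a : Params) (w : Vec d) (ξ : Fin n → Fin Bv → Z) : Prop :=
  ∑ i, softmax (a.α • estG p w ξ) i * estG p w ξ i ≤ a.ε / 2

open Classical in
/-- The oracle which client `i` uses in a round: the objective if the criterion holds, otherwise
the constraint. -/
def activeGrad (p : Problem n d Z) (a : Params) (w : Vec d) (ξ : Fin n → Fin Bv → Z)
    (i : Fin n) : Vec d → Z → Vec d :=
  if Accepts p a w ξ then p.gradf i else p.gradg i

open Classical in
/-- The aggregation weight of client `i` in a round. -/
def activeWeight (p : Problem n d Z) (a : Params) (w : Vec d) (ξ : Fin n → Fin Bv → Z)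
    (i : Fin n) : ℝ :=
  if Accepts p a w ξ then softmax (a.α • estF p w ξ) i else softmax (a.α • estG p w ξ) i

/-- The local parameters `w_{k,τ}^{(i)}` of client `i` in a round that starts at `w`. -/
def localPoint (p : Problem n d Z) (a : Params) (w : Vec d) (ξ : Fin n → Fin Bv → Z)
    (ζ : Fin n → ℕ → Fin Bg → Z) (i : Fin n) (τ : ℕ) : Vec d :=
  localIter (activeGrad p a w ξ i) a.γ w (ζ i) τ

/-- The local update direction `(w_{k,0}^{(i)} - w_{k,E}^{(i)}) / (γ E)`. -/
def localDirection (p : Problem n d Z) (a : Params) (w : Vec d) (ξ : Fin n → Fin Bv → Z)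
    (ζ : Fin n → ℕ → Fin Bg → Z) (i : Fin n) : Vec d :=
  (a.γ * a.E)⁻¹ • (localPoint p a w ξ ζ i 0 - localPoint p a w ξ ζ i a.E)

/-- The global parameters `w_k`. -/
def globalIter (p : Problem n d Z) (a : Params) (w₀ : Vec d) (x : Samples n Bv Bg Z) :
    ℕ → Vec d
  | 0 => w₀
  | k + 1 => globalIter p a w₀ x k -
      a.η • ∑ i, activeWeight p a (globalIter p a w₀ x k) (x.ξ k) i •
        localDirection p a (globalIter p a w₀ x k) (x.ξ k) (x.ζ k) i

open Classical in
/-- The set of rounds among the first `K` in which the criterion holds. -/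
def acceptedRounds (p : Problem n d Z) (a : Params) (w₀ : Vec d) (x : Samples n Bv Bg Z)
    (K : ℕ) : Finset ℕ :=
  (Finset.range K).filter fun k => Accepts p a (globalIter p a w₀ x k) (x.ξ k)

/-- The output: the average of `w_k` over the accepted rounds. -/
def output (p : Problem n d Z) (a : Params) (w₀ : Vec d) (x : Samples n Bv Bg Z) (K : ℕ) :
    Vec d :=
  ((acceptedRounds p a w₀ x K).card : ℝ)⁻¹ • ∑ k ∈ acceptedRounds p a w₀ x K,
    globalIter p a w₀ x k

/-- In the first `K` rounds every point at which a client evaluates functions or gradients lies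
in `Θ` (the case `τ = 0` is the global point `w_k`). -/
def StaysIn (p : Problem n d Z) (a : Params) (w₀ : Vec d) (x : Samples n Bv Bg Z) (K : ℕ)
    (Θ : Set (Vec d)) : Prop :=
  ∀ k < K, ∀ i, ∀ τ < a.E,
    localPoint p a (globalIter p a w₀ x k) (x.ξ k) (x.ζ k) i τ ∈ Θ

/-- The samples used in `K` rounds with `E` local steps are random variables, all mutually
independent, and those of client `i` have law `D_i`. -/
def IsSampling {Ω : Type*} [MeasurableSpace Ω] (μ : Measure Ω) (p : Problem n d Z)
    (K E : ℕ) (X : Ω → Samples n Bv Bg Z) : Prop :=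
  (∀ k < K, ∀ i s, Measurable (fun ω => (X ω).ξ k i s) ∧
    μ.map (fun ω => (X ω).ξ k i s) = p.dist i) ∧
  (∀ k < K, ∀ i, ∀ τ < E, ∀ s, Measurable (fun ω => (X ω).ζ k i τ s) ∧
    μ.map (fun ω => (X ω).ζ k i τ s) = p.dist i) ∧
  iIndepFun
    (fun (j : (Fin K × Fin n × Fin Bv) ⊕ (Fin K × Fin n × Fin E × Fin Bg)) (ω : Ω) =>
      match j with
      | .inl (k, i, s) => (X ω).ξ k i s
      | .inr (k, i, τ, s) => (X ω).ζ k i τ s) μ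

end Algorithm

/-! ### Constants -/

/-- The effective variance `σ̄_g² = (σ_g² / B_g) / (L² E)`. -/
def effVar (σg L : ℝ) (Bg E : ℕ) : ℝ :=
  (σg ^ 2 / Bg) / (L ^ 2 * E)

/-- The optimization error `ε'`. -/
def optError (D L σg δ : ℝ) (K E Bg : ℕ) : ℝ :=
  D * L / √((K : ℝ) / 32) *
    (1 + 2 * effVar σg L Bg E * (3 + 8 * Real.log (8 / δ) / K) +
      √(effVar σg L Bg E) * √(8 * Real.log (8 / δ)) * (1 + E / √(6 * (K : ℝ))))

/-- The tolerance `ε = ε' + 4 σ_ζ √(2 ln(12 K n / δ) / B_ζ)`. -/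
def tolerance (D L σg σv δ : ℝ) (n K E Bv Bg : ℕ) : ℝ :=
  optError D L σg δ K E Bg + 4 * σv * √(2 * Real.log (12 * K * n / δ) / Bv)

end SwitchingGradient

end

/-! The proof separates a deterministic analysis on a good event from a bound for the probability of
its complement.

Deterministic part. The potential is `‖w_k - y‖ ^ 2` with `y = w*`. As long as the local points stay
in `Θ`, a client's update direction is the average of `E` subgradients at its local points plus
averaged noise. The subgradient inequality and the Lipschitz bound turn its inner product with `w_k
- y` into the gap `h_i(w_k) - h_i(y)`, up to drift and noise (`le_inner_clientDirection`). Averaging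
with the softmax weights and expanding the square gives `round_progress`; telescoping over the
rounds bounds the sum of the weighted gaps by `K ε' / 2` (`sum_gap_le`, `constants_bound`).

Let `e = (ε - ε') / 2` bound the errors of the batch estimates. A rejected round has weighted gap
above `ε' / 2`, because the estimated constraint exceeds `ε / 2` while `g_i(w*) ≤ 0`. So not every
round is rejected, and the gaps of the accepted rounds average to at most `ε' / 2`. A softmax
average is within `ε' / 2` of the maximum (`le_softmax_sum`), so an accepted round has `F(w_k) -
F(w*)` at most its gap plus `ε' / 2 + 2 e`, and `G(w_k) ≤ ε`. Convexity carries both bounds to the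
average of the iterates (`output_guarantee`).

Probabilistic part. Gradient noise is set to zero where the point has left `Θ`. It is then
sub-Gaussian conditionally on every past, and on trajectories inside `Θ` it is the true noise. The
notion `SubG` joins a moment generating function bound to exponential moments of shifted squared
norms; it is dimension-free and stable under adding conditionally sub-Gaussian increments
(`SubG.add_of_indep`). Jensen's inequality moves the exponential inside the client weights, so the
gradient noise costs no union bound over clients. Independence of a round from its past multiplies
exponential moments (`lintegral_eexp_sum_roundValue_le`). Markov's inequality for one linear and one
quadratic functional of the noise, and a union bound over the batch estimates, give
`exists_exceptional_event`. -/

namespace SwitchingGradient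

/-! ### Iterated integrals along independent σ-algebras -/

/-- If `U` and `V` are independent, then in `∫ φ(U, V)` the variable `V` may be integrated first,
with `U` frozen. -/
theorem lintegral_le_of_indepFun {Ω A B : Type*} {m : MeasurableSpace Ω} {mA : MeasurableSpace A}
    {mB : MeasurableSpace B} {μ : Measure Ω} [IsProbabilityMeasure μ] {U : Ω → A} {V : Ω → B}
    (hU : Measurable U) (hV : Measurable V) (hind : IndepFun U V μ)
    {φ : A → B → ENNReal} (hφ : Measurable (fun q : A × B => φ q.1 q.2))
    {ψ : A → ENNReal} (hψ : ∀ a, ∫⁻ ω, φ a (V ω) ∂μ ≤ ψ a) :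
    ∫⁻ ω, φ (U ω) (V ω) ∂μ ≤ ∫⁻ ω, ψ (U ω) ∂μ := by
  have key := (indepFun_iff_map_prod_eq_prod_map_map hU.aemeasurable hV.aemeasurable).1 hind
  have : IsProbabilityMeasure (μ.map U) := Measure.isProbabilityMeasure_map hU.aemeasurable
  have : IsProbabilityMeasure (μ.map V) := Measure.isProbabilityMeasure_map hV.aemeasurable
  have e₁ : ∫⁻ ω, φ (U ω) (V ω) ∂μ
      = ∫⁻ q, φ q.1 q.2 ∂(μ.map (fun ω => (U ω, V ω))) := by
    rw [lintegral_map hφ (hU.prodMk hV)]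
  rw [e₁, key, lintegral_prod _ hφ.aemeasurable, lintegral_map hφ.lintegral_prod_right' hU]
  refine lintegral_mono fun ω => ?_
  have hφ' : Measurable (φ (U ω)) := hφ.comp measurable_prodMk_left
  rw [lintegral_map hφ' hV]
  exact hψ (U ω)

/-- The identity of `Ω`, read as a map onto `Ω` with a smaller σ-algebra, is a random variable
carrying exactly the information of that σ-algebra. This lets statements about independent variables
be applied to independent σ-algebras. -/
theorem indepFun_id_of_indep {Ω : Type*} {m₁ m₂ m : MeasurableSpace Ω} {μ : Measure Ω}
    (hind : Indep m₁ m₂ μ) : @IndepFun Ω Ω Ω m m₁ m₂ id id μ := by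
  have := @IndepFun_iff_Indep Ω Ω Ω m m₁ m₂ id id μ
  rw [MeasurableSpace.comap_id, MeasurableSpace.comap_id] at this
  exact this.2 hind

/-! ### Exponentials in `ℝ≥0∞` -/

/-- The exponential as an extended nonnegative real. -/
noncomputable def eexp (x : ℝ) : ENNReal := ENNReal.ofReal (Real.exp x)

theorem eexp_mono {x y : ℝ} (h : x ≤ y) : eexp x ≤ eexp y :=
  ENNReal.ofReal_le_ofReal (Real.exp_le_exp.2 h)

theorem eexp_add (x y : ℝ) : eexp (x + y) = eexp x * eexp y := by
  rw [eexp, Real.exp_add, ENNReal.ofReal_mul (Real.exp_nonneg _)]; rfl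

theorem eexp_zero : eexp 0 = 1 := by simp [eexp]

theorem eexp_ne_top (x : ℝ) : eexp x ≠ ⊤ := ENNReal.ofReal_ne_top

theorem eexp_pos (x : ℝ) : 0 < eexp x := ENNReal.ofReal_pos.2 (Real.exp_pos x)

theorem measurable_eexp : Measurable eexp := by
  unfold eexp; fun_prop

/-- Jensen's inequality for a finite convex combination. -/
theorem eexp_sum_le {ι : Type*} (s : Finset ι) (r x : ι → ℝ) (hr : ∀ i ∈ s, 0 ≤ r i)
    (hr1 : ∑ i ∈ s, r i = 1) :
    eexp (∑ i ∈ s, r i * x i) ≤ ∑ i ∈ s, ENNReal.ofReal (r i) * eexp (x i) := by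
  have h := convexOn_exp.map_sum_le hr hr1 (p := x) (fun _ _ => Set.mem_univ _)
  simp only [smul_eq_mul] at h
  refine (ENNReal.ofReal_le_ofReal h).trans ?_
  rw [ENNReal.ofReal_sum_of_nonneg (fun i hi => mul_nonneg (hr i hi) (Real.exp_nonneg _))]
  exact Finset.sum_le_sum fun i hi => by rw [ENNReal.ofReal_mul (hr i hi)]; rfl

/-- Markov's inequality in exponential form. -/
theorem measure_ge_le_eexp {Ω : Type*} {m : MeasurableSpace Ω} {μ : Measure Ω} {Y : Ω → ℝ}
    {C : ℝ} (hC : ∫⁻ ω, eexp (Y ω) ∂μ ≤ eexp C) (hY : Measurable Y) (t : ℝ) :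
    μ {ω | t ≤ Y ω} ≤ eexp (C - t) := by
  have h := mul_meas_ge_le_lintegral (μ := μ) (measurable_eexp.comp hY) (eexp t)
  have hsub : {ω | t ≤ Y ω} ⊆ {ω | eexp t ≤ (eexp ∘ Y) ω} := fun ω hω => eexp_mono hω
  have h2 : eexp t * μ {ω | t ≤ Y ω} ≤ eexp C :=
    (mul_le_mul_right (measure_mono hsub) _).trans (h.trans hC)
  have h3 : eexp C = eexp t * eexp (C - t) := by rw [← eexp_add]; ring_nf
  rw [h3] at h2
  exact (ENNReal.mul_le_mul_iff_right (eexp_pos t).ne' (eexp_ne_top t)).1 h2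

/-- Exponential moments of a sum of a past value and of an increment which is controlled
conditionally on the past. -/
theorem lintegral_eexp_add_le {Ω A B : Type*} {m : MeasurableSpace Ω} {mA : MeasurableSpace A}
    {mB : MeasurableSpace B} {μ : Measure Ω} [IsProbabilityMeasure μ] {U : Ω → A} {V : Ω → B}
    (hU : Measurable U) (hV : Measurable V) (hind : IndepFun U V μ)
    {S : A → ℝ} {φ : A → B → ℝ} (hS : Measurable S)
    (hφ : Measurable (fun q : A × B => φ q.1 q.2))
    {C C' : ℝ} (hC : ∫⁻ ω, eexp (S (U ω)) ∂μ ≤ eexp C)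
    (hC' : ∀ a, ∫⁻ ω, eexp (φ a (V ω)) ∂μ ≤ eexp C') :
    ∫⁻ ω, eexp (S (U ω) + φ (U ω) (V ω)) ∂μ ≤ eexp (C + C') := by
  have h := lintegral_le_of_indepFun hU hV hind
    (φ := fun a b => eexp (S a + φ a b))
    (measurable_eexp.comp ((hS.comp measurable_fst).add hφ))
    (ψ := fun a => eexp (S a) * eexp C') (fun a => by
      simp only [eexp_add]
      rw [lintegral_const_mul' _ _ (eexp_ne_top _)]
      exact mul_le_mul_right (hC' a) _)
  refine h.trans ?_
  rw [lintegral_mul_const' _ _ (eexp_ne_top _), eexp_add]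
  exact mul_le_mul_left hC _

/-! ### Sub-Gaussian random vectors -/

/-- Dimension-free sub-Gaussianity with variance proxy `2κ`: a bound for the moment generating
function, and one for exponential moments of shifted squared norms which is stable under sums. -/
def SubG {Ω V : Type*} {m : MeasurableSpace Ω} [NormedAddCommGroup V] [InnerProductSpace ℝ V]
    (κ : ℝ) (Y : Ω → V) (μ : Measure Ω) : Prop :=
  (∀ u : V, ∫⁻ ω, eexp (inner ℝ u (Y ω)) ∂μ ≤ eexp (κ * ‖u‖ ^ 2)) ∧
  ∀ (s : V) (c : ℝ), 8 * κ < c →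
    ∫⁻ ω, eexp (‖s + Y ω‖ ^ 2 / c) ∂μ ≤ eexp ((κ + ‖s‖ ^ 2) / (c - 8 * κ))

section SubG

variable {Ω V : Type*} {m : MeasurableSpace Ω} {μ : Measure Ω}
  [NormedAddCommGroup V] [InnerProductSpace ℝ V]

theorem SubG.zero [IsProbabilityMeasure μ] : SubG 0 (fun _ : Ω => (0 : V)) μ := by
  refine ⟨fun u => by simp, fun s c _ => by simp⟩

theorem SubG.mono {κ κ' : ℝ} {Y : Ω → V} (h : SubG κ Y μ) (h0 : 0 ≤ κ) (hκ : κ ≤ κ') :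
    SubG κ' Y μ := by
  refine ⟨fun u => (h.1 u).trans (eexp_mono (by gcongr)), fun s c hc =>
    (h.2 s c (by linarith)).trans (eexp_mono ?_)⟩
  have : 0 < c - 8 * κ' := by linarith
  have : 0 ≤ κ' + ‖s‖ ^ 2 := add_nonneg (h0.trans hκ) (sq_nonneg _)
  gcongr

theorem SubG.smul {κ : ℝ} {Y : Ω → V} (h : SubG κ Y μ) {b : ℝ} (hb : 0 < b) :
    SubG (b ^ 2 * κ) (fun ω => b • Y ω) μ := by
  refine ⟨fun u => ?_, fun s c hc => ?_⟩
  · have := h.1 (b • u)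
    simp only [inner_smul_left, inner_smul_right, norm_smul, mul_pow, Real.norm_eq_abs, sq_abs,
      RCLike.conj_to_real] at this ⊢
    convert this using 2
    ring
  · have hb2 : 0 < b ^ 2 := by positivity
    have hc' : 8 * κ < c / b ^ 2 := by
      rw [lt_div_iff₀ hb2]; linarith
    have := h.2 (b⁻¹ • s) (c / b ^ 2) hc'
    have e : ∀ ω, s + b • Y ω = b • (b⁻¹ • s + Y ω) := fun ω => by
      rw [smul_add, smul_smul, mul_inv_cancel₀ hb.ne', one_smul]
    simp only [e, norm_smul, mul_pow, Real.norm_eq_abs, sq_abs, abs_inv, inv_pow] at this ⊢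
    have hd : c / b ^ 2 - 8 * κ ≠ 0 := by linarith
    have hd' : c - 8 * (b ^ 2 * κ) ≠ 0 := by linarith
    have e2 : (κ + (b ^ 2)⁻¹ * ‖s‖ ^ 2) / (c / b ^ 2 - 8 * κ)
        = (b ^ 2 * κ + ‖s‖ ^ 2) / (c - 8 * (b ^ 2 * κ)) := by
      rw [div_eq_div_iff hd hd']; field_simp
    rw [e2] at this
    convert this using 3 with ω
    congr 1
    field_simp

theorem SubG.map {Z : Type*} {mZ : MeasurableSpace Z} {P : Measure Z} {κ : ℝ} {Y : Z → V}
    [MeasurableSpace V] [BorelSpace V] [SecondCountableTopology V]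
    (h : SubG κ Y P) (hY : Measurable Y) {S : Ω → Z} (hS : Measurable S) (hP : μ.map S = P) :
    SubG κ (fun ω => Y (S ω)) μ := by
  subst hP
  refine ⟨fun u => ?_, fun s c hc => ?_⟩
  · have := h.1 u
    rwa [lintegral_map (f := fun z => eexp (inner ℝ u (Y z)))
      (measurable_eexp.comp (by fun_prop)) hS] at this
  · have := h.2 s c hc
    rwa [lintegral_map (f := fun z => eexp (‖s + Y z‖ ^ 2 / c))
      (measurable_eexp.comp (by fun_prop)) hS] at this

/-- Sub-Gaussianity of a sum of a past value and of an increment that is sub-Gaussian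
conditionally on the past. -/
theorem SubG.add_of_indepFun [IsProbabilityMeasure μ] [MeasurableSpace V] [BorelSpace V] [SecondCountableTopology V]
    {A B : Type*} {mA : MeasurableSpace A} {mB : MeasurableSpace B} {X : Ω → A} {X' : Ω → B}
    (hX : Measurable X) (hX' : Measurable X') (hind : IndepFun X X' μ)
    {κ₁ κ₂ : ℝ} (hκ₁ : 0 ≤ κ₁) (hκ₂ : 0 ≤ κ₂) {N : A → V} {Y : A → B → V}
    (hN : Measurable N) (hY : Measurable (fun q : A × B => Y q.1 q.2))
    (hN' : SubG κ₁ (fun ω => N (X ω)) μ) (hY' : ∀ a, SubG κ₂ (fun ω => Y a (X' ω)) μ) :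
    SubG (κ₁ + κ₂) (fun ω => N (X ω) + Y (X ω) (X' ω)) μ := by
  have hNY : Measurable (fun q : A × B => N q.1 + Y q.1 q.2) := by fun_prop
  refine ⟨fun u => ?_, fun s c hc => ?_⟩
  · have := lintegral_le_of_indepFun hX hX' hind
      (φ := fun a b => eexp (inner ℝ u (N a + Y a b)))
      (measurable_eexp.comp (by fun_prop))
      (ψ := fun a => eexp (inner ℝ u (N a)) * eexp (κ₂ * ‖u‖ ^ 2)) (fun a => by
        simp only [inner_add_right, eexp_add]
        rw [lintegral_const_mul' _ _ (eexp_ne_top _)]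
        exact mul_le_mul_right ((hY' a).1 u) _)
    refine this.trans ?_
    rw [lintegral_mul_const' _ _ (eexp_ne_top _)]
    refine (mul_le_mul_left (hN'.1 u) _).trans (le_of_eq ?_)
    rw [← eexp_add]; ring_nf
  · have hd : 0 < c - 8 * (κ₁ + κ₂) := by linarith
    -- Integrating the increment with the past frozen replaces `c` by `c - 8κ₂`; the bound for the
    -- past then subtracts `8κ₁`. The bound in `SubG` is shaped so that these losses add up.
    have := lintegral_le_of_indepFun hX hX' hind
      (φ := fun a b => eexp (‖s + (N a + Y a b)‖ ^ 2 / c))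
      (measurable_eexp.comp (by fun_prop))
      (ψ := fun a => eexp (‖s + N a‖ ^ 2 / (c - 8 * κ₂)) * eexp (κ₂ / (c - 8 * κ₂))) (fun a => by
        have := (hY' a).2 (s + N a) c (by linarith)
        simp only [← add_assoc]
        rwa [add_comm κ₂, add_div, eexp_add] at this)
    refine this.trans ?_
    rw [lintegral_mul_const' _ _ (eexp_ne_top _)]
    refine (mul_le_mul_left (hN'.2 s (c - 8 * κ₂) (by linarith)) _).trans ?_
    rw [← eexp_add]
    refine eexp_mono ?_
    have e : c - 8 * κ₂ - 8 * κ₁ = c - 8 * (κ₁ + κ₂) := by ring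
    rw [e]
    have : κ₂ / (c - 8 * κ₂) ≤ κ₂ / (c - 8 * (κ₁ + κ₂)) := by
      gcongr; linarith
    calc _ ≤ (κ₁ + ‖s‖ ^ 2) / (c - 8 * (κ₁ + κ₂)) + κ₂ / (c - 8 * (κ₁ + κ₂)) := by gcongr
      _ = _ := by rw [← add_div]; ring_nf

end SubG

/-- `exp x ≤ x + exp (x²)`. -/
theorem exp_le_self_add_exp_sq (x : ℝ) : Real.exp x ≤ x + Real.exp (x ^ 2) := by
  have h2 := Real.add_one_le_exp (x ^ 2)
  rcases le_or_gt |x| 1 with h | h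
  · have := (abs_le.1 (Real.abs_exp_sub_one_sub_id_le h)).2
    linarith
  · rcases lt_abs.1 h with h | h
    · have : Real.exp x ≤ Real.exp (x ^ 2) := Real.exp_le_exp.2 (by nlinarith)
      linarith
    · have : Real.exp x ≤ 1 := Real.exp_le_one_iff.2 (by linarith)
      nlinarith

/-! ### Sub-Gaussianity from a bound on the exponential moment of the square. -/

section ExpSq

variable {Z : Type*} {mZ : MeasurableSpace Z} {P : Measure Z} [IsProbabilityMeasure P]

/-- Convexity gives `exp (θ Y) ≤ 1 - θ + θ exp Y`, so the mean is at most `1 + θ ≤ exp θ`. -/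
theorem lintegral_eexp_mul_le {Y : Z → ℝ} (h : ∫⁻ z, eexp (Y z) ∂P ≤ 2) {θ : ℝ} (h0 : 0 ≤ θ)
    (h1 : θ ≤ 1) : ∫⁻ z, eexp (θ * Y z) ∂P ≤ eexp θ := by
  have hp : ∀ z, eexp (θ * Y z) ≤ ENNReal.ofReal (1 - θ) + ENNReal.ofReal θ * eexp (Y z) := by
    intro z
    have := convexOn_exp.2 (Set.mem_univ (0 : ℝ)) (Set.mem_univ (Y z)) (sub_nonneg.2 h1) h0
      (by ring)
    simp only [smul_eq_mul, mul_zero, zero_add, Real.exp_zero, mul_one] at this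
    refine (ENNReal.ofReal_le_ofReal this).trans ?_
    rw [ENNReal.ofReal_add (by linarith) (by positivity), ENNReal.ofReal_mul h0]
    rfl
  refine (lintegral_mono hp).trans ?_
  rw [lintegral_add_left measurable_const, lintegral_const, measure_univ, mul_one,
    lintegral_const_mul' _ _ ENNReal.ofReal_ne_top]
  refine (add_le_add_right (mul_le_mul_right h _) _).trans ?_
  have e : ENNReal.ofReal θ * 2 = ENNReal.ofReal (θ * 2) := by
    rw [ENNReal.ofReal_mul h0]; simp
  rw [e, ← ENNReal.ofReal_add (by linarith) (by positivity)]
  refine ENNReal.ofReal_le_ofReal ?_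
  have := Real.add_one_le_exp θ
  linarith

/-- The moment generating function of a centred variable with `E exp(Y²/σ²) ≤ 2`. -/
theorem lintegral_eexp_le_of_exp_sq {Y : Z → ℝ} (hY : Integrable Y P) (h0 : ∫ z, Y z ∂P = 0)
    {σ : ℝ} (hσ : 0 < σ) (h : ∫⁻ z, eexp (Y z ^ 2 / σ ^ 2) ∂P ≤ 2) (t : ℝ) :
    ∫⁻ z, eexp (t * Y z) ∂P ≤ eexp (t ^ 2 * σ ^ 2) := by
  -- For small `t`, `exp x ≤ x + exp (x²)` at `x = tY` loses its linear term to centring, and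
  -- interpolation bounds the rest. For large `t`, `tY ≤ t²σ²/2 + Y²/(2σ²)` suffices, because the
  -- constant `exp (1/2)` is then absorbed by `exp (t²σ²/2)`.
  rcases le_or_gt (t ^ 2 * σ ^ 2) 1 with h1 | h1
  · have hsq := lintegral_eexp_mul_le h (by positivity) h1
    have e : ∀ z, t ^ 2 * σ ^ 2 * (Y z ^ 2 / σ ^ 2) = (t * Y z) ^ 2 := fun z => by
      field_simp
    simp only [e] at hsq
    have haem : AEMeasurable Y P := hY.aemeasurable
    have hm2 : AEStronglyMeasurable (fun z => Real.exp ((t * Y z) ^ 2)) P :=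
      (Real.measurable_exp.comp_aemeasurable ((haem.const_mul t).pow_const 2)).aestronglyMeasurable
    have hi2 : Integrable (fun z => Real.exp ((t * Y z) ^ 2)) P := by
      refine ⟨hm2, ?_⟩
      rw [hasFiniteIntegral_iff_ofReal (Filter.Eventually.of_forall fun z => Real.exp_nonneg _)]
      exact lt_of_le_of_lt hsq (eexp_ne_top _).lt_top
    have hi1 : Integrable (fun z => t * Y z) P := hY.const_mul t
    have hle : ∀ z, Real.exp (t * Y z) ≤ t * Y z + Real.exp ((t * Y z) ^ 2) := fun z =>
      exp_le_self_add_exp_sq _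
    calc ∫⁻ z, eexp (t * Y z) ∂P
        ≤ ∫⁻ z, ENNReal.ofReal (t * Y z + Real.exp ((t * Y z) ^ 2)) ∂P :=
          lintegral_mono fun z => ENNReal.ofReal_le_ofReal (hle z)
      _ = ENNReal.ofReal (∫ z, (t * Y z + Real.exp ((t * Y z) ^ 2)) ∂P) :=
          (ofReal_integral_eq_lintegral_ofReal (hi1.add hi2)
            (Filter.Eventually.of_forall fun z => (Real.exp_nonneg _).trans (hle z))).symm
      _ = ENNReal.ofReal (∫ z, Real.exp ((t * Y z) ^ 2) ∂P) := by
          rw [integral_add hi1 hi2, integral_const_mul, h0, mul_zero, zero_add]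
      _ = ∫⁻ z, eexp ((t * Y z) ^ 2) ∂P :=
          ofReal_integral_eq_lintegral_ofReal hi2
            (Filter.Eventually.of_forall fun z => Real.exp_nonneg _)
      _ ≤ _ := hsq
  · have hsq := lintegral_eexp_mul_le h (by norm_num : (0 : ℝ) ≤ 1 / 2) (by norm_num)
    have hp : ∀ z, eexp (t * Y z) ≤ eexp (t ^ 2 * σ ^ 2 / 2) * eexp (1 / 2 * (Y z ^ 2 / σ ^ 2)) := by
      intro z
      rw [← eexp_add]
      refine eexp_mono ?_
      have e : t * Y z = (t * σ) * (Y z / σ) := by field_simp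
      have := two_mul_le_add_sq (t * σ) (Y z / σ)
      rw [div_pow] at this
      rw [e]; nlinarith
    refine (lintegral_mono hp).trans ?_
    rw [lintegral_const_mul' _ _ (eexp_ne_top _)]
    refine (mul_le_mul_right hsq _).trans ?_
    rw [← eexp_add]
    exact eexp_mono (by linarith)

/-- The first half reduces to the scalar case along the unit vector of `u`. For the second, `‖s +
Y‖²` is expanded: the cross term is controlled by the moment generating function and `‖Y‖²` by the
hypothesis, so the dimension never enters. -/
theorem subG_of_exp_sq {V : Type*} [NormedAddCommGroup V] [InnerProductSpace ℝ V]
    [CompleteSpace V] {Y : Z → V} (hY : Integrable Y P) (h0 : ∫ z, Y z ∂P = 0) {σ : ℝ}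
    (hσ : 0 < σ) (h : ∫⁻ z, eexp (‖Y z‖ ^ 2 / σ ^ 2) ∂P ≤ 2) : SubG (σ ^ 2) Y P := by
  have hmgf : ∀ u : V, ∫⁻ z, eexp (inner ℝ u (Y z)) ∂P ≤ eexp (σ ^ 2 * ‖u‖ ^ 2) := by
    intro u
    rcases eq_or_ne u 0 with rfl | hu
    · simp [eexp_zero]
    have hu' : 0 < ‖u‖ := norm_pos_iff.2 hu
    have hint : Integrable (fun z => ‖u‖⁻¹ * inner ℝ u (Y z)) P :=
      (hY.const_inner u).const_mul _
    have hzero : ∫ z, ‖u‖⁻¹ * inner ℝ u (Y z) ∂P = 0 := by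
      rw [integral_const_mul, integral_inner hY, h0, inner_zero_right, mul_zero]
    have hexp : ∫⁻ z, eexp ((‖u‖⁻¹ * inner ℝ u (Y z)) ^ 2 / σ ^ 2) ∂P ≤ 2 := by
      refine (lintegral_mono fun z => eexp_mono ?_).trans h
      gcongr ?_ / _
      rw [sq_le_sq, abs_norm, abs_mul, abs_inv, abs_norm, inv_mul_le_iff₀ hu']
      exact abs_real_inner_le_norm _ _
    have := lintegral_eexp_le_of_exp_sq hint hzero hσ hexp ‖u‖
    simp only [mul_inv_cancel_left₀ hu'.ne'] at this
    rwa [mul_comm (σ ^ 2)]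
  refine ⟨hmgf, fun s c hc => ?_⟩
  have hσ2 : 0 < σ ^ 2 := by positivity
  have hc0 : 0 < c := by linarith
  have hA : ∫⁻ z, eexp (2 * (2 * inner ℝ s (Y z) / c) - 2 * (8 * σ ^ 2 * ‖s‖ ^ 2 / c ^ 2)) ∂P
      ≤ 1 := by
    have := hmgf ((4 / c) • s)
    simp only [inner_smul_left, RCLike.conj_to_real, norm_smul, Real.norm_eq_abs, mul_pow,
      sq_abs] at this
    simp only [sub_eq_add_neg, eexp_add]
    rw [lintegral_mul_const' _ _ (eexp_ne_top _)]
    have e : ∀ z, 2 * (2 * inner ℝ s (Y z) / c) = 4 / c * inner ℝ s (Y z) := fun z => by ring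
    simp only [e]
    refine (mul_le_mul_left this _).trans (le_of_eq ?_)
    rw [← eexp_add, ← eexp_zero]
    congr 1
    field_simp; ring
  have hB : ∫⁻ z, eexp (2 * (‖Y z‖ ^ 2 / c) - 2 * (σ ^ 2 / c)) ∂P ≤ 1 := by
    have := lintegral_eexp_mul_le h (θ := 2 * σ ^ 2 / c) (by positivity)
      (by rw [div_le_one hc0]; linarith)
    simp only [sub_eq_add_neg, eexp_add]
    rw [lintegral_mul_const' _ _ (eexp_ne_top _)]
    have e : ∀ z, 2 * (‖Y z‖ ^ 2 / c) = 2 * σ ^ 2 / c * (‖Y z‖ ^ 2 / σ ^ 2) := fun z => by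
      field_simp
    simp only [e]
    refine (mul_le_mul_left this _).trans (le_of_eq ?_)
    rw [← eexp_add, ← eexp_zero]
    congr 1
    ring
  set α : ℝ := 8 * σ ^ 2 * ‖s‖ ^ 2 / c ^ 2
  set β : ℝ := σ ^ 2 / c
  -- Jensen with weights 1/2 separates the cross term from the square. This doubles their exponents,
  -- and `α`, `β` are the corrections that make each doubled exponential have mean at most one.
  have hp : ∀ z, eexp (‖s + Y z‖ ^ 2 / c) ≤ eexp (‖s‖ ^ 2 / c + α + β) *
      (ENNReal.ofReal (1 / 2) * eexp (2 * (2 * inner ℝ s (Y z) / c) - 2 * α) +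
        ENNReal.ofReal (1 / 2) * eexp (2 * (‖Y z‖ ^ 2 / c) - 2 * β)) := by
    intro z
    have e : ‖s + Y z‖ ^ 2 / c = (‖s‖ ^ 2 / c + α + β) +
        (1 / 2 * (2 * (2 * inner ℝ s (Y z) / c) - 2 * α) +
          1 / 2 * (2 * (‖Y z‖ ^ 2 / c) - 2 * β)) := by
      rw [norm_add_sq_real]; ring
    rw [e, eexp_add]
    refine mul_le_mul_right ?_ _
    have := eexp_sum_le Finset.univ (fun _ : Fin 2 => (1 / 2 : ℝ))
      ![2 * (2 * inner ℝ s (Y z) / c) - 2 * α, 2 * (‖Y z‖ ^ 2 / c) - 2 * β]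
      (fun _ _ => by norm_num) (by simp)
    simpa [Fin.sum_univ_two] using this
  refine (lintegral_mono hp).trans ?_
  have haem : AEStronglyMeasurable Y P := hY.aestronglyMeasurable
  have hmA : AEMeasurable (fun z => ENNReal.ofReal (1 / 2) *
      eexp (2 * (2 * inner ℝ s (Y z) / c) - 2 * α)) P := by
    refine (measurable_eexp.comp_aemeasurable ?_).const_mul _
    have : AEMeasurable (fun z => inner ℝ s (Y z)) P := (hY.const_inner s).aemeasurable
    exact (((this.const_mul 2).div_const c).const_mul 2).sub_const _
  rw [lintegral_const_mul' _ _ (eexp_ne_top _), lintegral_add_left' hmA,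
    lintegral_const_mul' _ _ ENNReal.ofReal_ne_top, lintegral_const_mul' _ _ ENNReal.ofReal_ne_top]
  have hsum : ENNReal.ofReal (1 / 2) * ∫⁻ z, eexp (2 * (2 * inner ℝ s (Y z) / c) - 2 * α) ∂P +
      ENNReal.ofReal (1 / 2) * ∫⁻ z, eexp (2 * (‖Y z‖ ^ 2 / c) - 2 * β) ∂P ≤ 1 := by
    refine (add_le_add (mul_le_mul_right hA _) (mul_le_mul_right hB _)).trans (le_of_eq ?_)
    rw [mul_one, ← ENNReal.ofReal_add (by norm_num) (by norm_num)]
    norm_num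
  refine (mul_le_mul_right hsum _).trans ?_
  rw [mul_one]
  refine eexp_mono ?_
  have hd : 0 < c - 8 * σ ^ 2 := by linarith
  have e1 : ‖s‖ ^ 2 / c + α + β = (‖s‖ ^ 2 * (c + 8 * σ ^ 2)) / c ^ 2 + σ ^ 2 / c := by
    simp only [α, β]; field_simp
  -- The comparison rests on `(c + 8σ²)(c - 8σ²) ≤ c²`; this is where the denominator `c - 8κ` comes
  -- from.
  rw [e1, add_div, add_comm]
  refine add_le_add ?_ ?_
  · gcongr; linarith
  · rw [div_le_div_iff₀ (by positivity) hd]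
    have : 0 ≤ ‖s‖ ^ 2 * (8 * σ ^ 2) ^ 2 := by positivity
    nlinarith

end ExpSq

/-! ### σ-algebras generated by subfamilies -/

/-- The σ-algebra generated by the variables `Y j`, `j ∈ S`. -/
@[reducible] def sigmaOf {J Ω Z : Type*} [mZ : MeasurableSpace Z] (Y : J → Ω → Z) (S : Set J) :
    MeasurableSpace Ω :=
  ⨆ j ∈ S, MeasurableSpace.comap (Y j) mZ

section SigmaOf

variable {J Ω Z : Type*} [mZ : MeasurableSpace Z] {Y : J → Ω → Z} {S T : Set J}

theorem measurable_sigmaOf {j : J} (hj : j ∈ S) : Measurable[sigmaOf Y S] (Y j) := by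
  rw [measurable_iff_comap_le]
  exact le_iSup₂_of_le j hj le_rfl

theorem sigmaOf_le {m : MeasurableSpace Ω} (hY : ∀ j, Measurable (Y j)) : sigmaOf Y S ≤ m :=
  iSup₂_le fun j _ => (hY j).comap_le

theorem indep_sigmaOf {m : MeasurableSpace Ω} {μ : Measure Ω} (hY : ∀ j, Measurable (Y j))
    (hind : iIndepFun Y μ) (hST : Disjoint S T) : Indep (sigmaOf Y S) (sigmaOf Y T) μ :=
  indep_iSup_of_disjoint (fun j => (hY j).comap_le)
    ((iIndepFun_iff_iIndep (fun _ => mZ) Y μ).1 hind) hST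

end SigmaOf

/-! ### Past and present as independent σ-algebras -/

/-- The two arguments of `φ` separate past from present: `φ` sees the first only through `m₁` and
the second only through `m₂`. The diagonal is the actual random quantity, and independence permits
integrating the present with the past frozen. -/
theorem lintegral_diag_le_of_indep {Ω : Type*} {m₁ m₂ m : MeasurableSpace Ω} {μ : Measure Ω}
    [IsProbabilityMeasure μ] (h₁ : m₁ ≤ m) (h₂ : m₂ ≤ m) (hind : Indep m₁ m₂ μ)
    {φ : Ω → Ω → ENNReal} (hφ : Measurable[m₁.prod m₂] (fun q : Ω × Ω => φ q.1 q.2))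
    {ψ : Ω → ENNReal} (hψ : ∀ ω, ∫⁻ ω', φ ω ω' ∂μ ≤ ψ ω) :
    ∫⁻ ω, φ ω ω ∂μ ≤ ∫⁻ ω, ψ ω ∂μ :=
  @lintegral_le_of_indepFun Ω Ω Ω m m₁ m₂ μ _ id id (measurable_id'' h₁) (measurable_id'' h₂)
    (indepFun_id_of_indep hind) φ hφ ψ hψ

theorem lintegral_eexp_add_le_of_indep {Ω : Type*} {m₁ m₂ m : MeasurableSpace Ω} {μ : Measure Ω}
    [IsProbabilityMeasure μ] (h₁ : m₁ ≤ m) (h₂ : m₂ ≤ m) (hind : Indep m₁ m₂ μ)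
    {S : Ω → ℝ} {φ : Ω → Ω → ℝ} (hS : Measurable[m₁] S)
    (hφ : Measurable[m₁.prod m₂] (fun q : Ω × Ω => φ q.1 q.2))
    {C C' : ℝ} (hC : ∫⁻ ω, eexp (S ω) ∂μ ≤ eexp C)
    (hC' : ∀ ω, ∫⁻ ω', eexp (φ ω ω') ∂μ ≤ eexp C') :
    ∫⁻ ω, eexp (S ω + φ ω ω) ∂μ ≤ eexp (C + C') :=
  @lintegral_eexp_add_le Ω Ω Ω m m₁ m₂ μ _ id id (measurable_id'' h₁) (measurable_id'' h₂)
    (indepFun_id_of_indep hind) S φ hS hφ C C' hC hC'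

theorem SubG.add_of_indep {Ω V : Type*} {m₁ m₂ m : MeasurableSpace Ω} {μ : Measure Ω}
    [IsProbabilityMeasure μ] [NormedAddCommGroup V] [InnerProductSpace ℝ V] [MeasurableSpace V]
    [BorelSpace V] [SecondCountableTopology V] (h₁ : m₁ ≤ m) (h₂ : m₂ ≤ m) (hind : Indep m₁ m₂ μ)
    {κ₁ κ₂ : ℝ} (hκ₁ : 0 ≤ κ₁) (hκ₂ : 0 ≤ κ₂) {N : Ω → V} {Y : Ω → Ω → V}
    (hN : Measurable[m₁] N) (hY : Measurable[m₁.prod m₂] (fun q : Ω × Ω => Y q.1 q.2))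
    (hN' : SubG κ₁ N μ) (hY' : ∀ ω, SubG κ₂ (Y ω) μ) :
    SubG (κ₁ + κ₂) (fun ω => N ω + Y ω ω) μ :=
  @SubG.add_of_indepFun Ω V m μ _ _ _ _ _ _ Ω Ω m₁ m₂ id id (measurable_id'' h₁)
    (measurable_id'' h₂) (indepFun_id_of_indep hind) κ₁ κ₂ hκ₁ hκ₂ N Y hN hY hN' hY'

/-! ### Measurability of the local iteration -/

section Measurability

variable {n d B : ℕ} {Z : Type*} [MeasurableSpace Z] {Ω : Type*} [MeasurableSpace Ω]

theorem measurable_batchMean {V : Type*} [NormedAddCommGroup V] [NormedSpace ℝ V]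
    [MeasurableSpace V] [BorelSpace V] [SecondCountableTopology V] {v : Vec d → Z → V}
    (hv : Measurable (fun x : Vec d × Z => v x.1 x.2)) {W : Ω → Vec d} (hW : Measurable W)
    {X : Ω → Fin B → Z} (hX : ∀ s, Measurable (fun ω => X ω s)) :
    Measurable (fun ω => batchMean v (W ω) (X ω)) := by
  unfold batchMean
  refine Measurable.const_smul (Finset.measurable_sum _ fun s _ => ?_) _
  exact hv.comp (hW.prodMk (hX s))

theorem measurable_localIter {v : Vec d → Z → Vec d}
    (hv : Measurable (fun x : Vec d × Z => v x.1 x.2)) (γ : ℝ) {W : Ω → Vec d} (hW : Measurable W)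
    {X : Ω → ℕ → Fin B → Z} (τ : ℕ) (hX : ∀ t < τ, ∀ s, Measurable (fun ω => X ω t s)) :
    Measurable (fun ω => localIter v γ (W ω) (X ω) τ) := by
  induction τ with
  | zero => exact hW
  | succ τ ih =>
    have h := ih fun t ht => hX t (ht.trans τ.lt_succ_self)
    exact h.sub ((measurable_batchMean hv h (hX τ τ.lt_succ_self)).const_smul γ)

end Measurability

/-! ### Gradient noise -/

/-- The error of a batch average at `w`, set to zero outside `Θ`. -/
noncomputable def noise {d B : ℕ} {Z V : Type*} [MeasurableSpace Z] [NormedAddCommGroup V]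
    [NormedSpace ℝ V] (Θ : Set (Vec d)) (v : Vec d → Z → V) (P : Measure Z) (w : Vec d)
    (x : Fin B → Z) : V :=
  open Classical in if w ∈ Θ then batchMean v w x - ∫ z, v w z ∂P else 0

/-- The accumulated gradient noise of the first `τ` local steps. -/
noncomputable def noiseSum {d B : ℕ} {Z : Type*} [MeasurableSpace Z] (Θ : Set (Vec d))
    (v : Vec d → Z → Vec d) (P : Measure Z) (γ : ℝ) (w : Vec d) (x : ℕ → Fin B → Z) (τ : ℕ) :
    Vec d :=
  ∑ t ∈ Finset.range τ, noise Θ v P (localIter v γ w x t) (x t)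

section Noise

variable {d B : ℕ} {Z : Type*} [MeasurableSpace Z] {Θ : Set (Vec d)} {v : Vec d → Z → Vec d}
  {P : Measure Z} [IsProbabilityMeasure P] {Ω : Type*} [mΩ : MeasurableSpace Ω]

theorem measurable_integral_param {V : Type*} [NormedAddCommGroup V] [NormedSpace ℝ V]
    [MeasurableSpace V] [BorelSpace V] [SecondCountableTopology V] {v : Vec d → Z → V}
    (hv : Measurable (fun x : Vec d × Z => v x.1 x.2)) : Measurable fun w => ∫ z, v w z ∂P :=
  (StronglyMeasurable.integral_prod_right (f := fun w z => v w z)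
    hv.stronglyMeasurable).measurable

theorem measurable_noise {V : Type*} [NormedAddCommGroup V] [NormedSpace ℝ V]
    [MeasurableSpace V] [BorelSpace V] [SecondCountableTopology V] {v : Vec d → Z → V}
    (hΘ : MeasurableSet Θ)
    (hv : Measurable (fun x : Vec d × Z => v x.1 x.2)) {W : Ω → Vec d} (hW : Measurable W)
    {X : Ω → Fin B → Z} (hX : ∀ s, Measurable (fun ω => X ω s)) :
    Measurable (fun ω => noise Θ v P (W ω) (X ω)) := by
  classical
  unfold noise
  exact Measurable.ite (hW hΘ)
    ((measurable_batchMean hv hW hX).sub ((measurable_integral_param hv).comp hW)) measurable_const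

theorem measurable_noiseSum (hΘ : MeasurableSet Θ)
    (hv : Measurable (fun x : Vec d × Z => v x.1 x.2)) (γ : ℝ) {W : Ω → Vec d} (hW : Measurable W)
    {X : Ω → ℕ → Fin B → Z} (τ : ℕ) (hX : ∀ t < τ, ∀ s, Measurable (fun ω => X ω t s)) :
    Measurable (fun ω => noiseSum Θ v P γ (W ω) (X ω) τ) := by
  unfold noiseSum
  refine Finset.measurable_sum _ fun t ht => ?_
  have ht' := Finset.mem_range.1 ht
  exact measurable_noise hΘ hv
    (measurable_localIter hv γ hW t fun t' h => hX t' (h.trans ht')) (hX t ht')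

end Noise

section SubGNoise

variable {d B : ℕ} {Z : Type*} [MeasurableSpace Z] {P : Measure Z} [IsProbabilityMeasure P]
  {Ω : Type*} [mΩ : MeasurableSpace Ω] {μ : Measure Ω} [IsProbabilityMeasure μ]

theorem subG_sum {ι V : Type*} [NormedAddCommGroup V] [InnerProductSpace ℝ V] [MeasurableSpace V]
    [BorelSpace V] [SecondCountableTopology V] {κ : ℝ} (hκ : 0 ≤ κ) {Y : ι → Ω → V}
    (hY : ∀ s, Measurable (Y s)) (hind : iIndepFun Y μ) (h : ∀ s, SubG κ (Y s) μ)
    (S : Finset ι) : SubG (S.card * κ) (fun ω => ∑ s ∈ S, Y s ω) μ := by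
  classical
  induction S using Finset.induction_on with
  | empty => simpa using SubG.zero
  | insert a S ha ih =>
    have hI := hind.indepFun_finsetSum_of_notMem hY ha
    have e : (∑ s ∈ S, Y s) = fun ω => ∑ s ∈ S, Y s ω := by ext; simp
    rw [e] at hI
    have := SubG.add_of_indepFun (Finset.measurable_sum S fun s _ => hY s) (hY a) hI
      (κ₁ := S.card * κ) (κ₂ := κ) (by positivity) hκ (N := id) (Y := fun _ b => b)
      measurable_id measurable_snd ih (fun _ => h a)
    rw [Finset.card_insert_of_notMem ha]
    simp only [Finset.sum_insert ha, id] at this ⊢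
    convert this using 1
    · push_cast; ring
    · ext ω; rw [add_comm]

/-- A batch average of independent centred samples. -/
theorem subG_batchMean_sub (hB : 1 ≤ B) {V : Type*} [NormedAddCommGroup V]
    [InnerProductSpace ℝ V] [CompleteSpace V] [MeasurableSpace V] [BorelSpace V]
    [SecondCountableTopology V] {v : Vec d → Z → V}
    (hv : Measurable (fun x : Vec d × Z => v x.1 x.2)) {w : Vec d} (hint : Integrable (v w) P)
    {σ : ℝ} (hσ : 0 < σ)
    (hexp : ∫⁻ z, eexp (‖v w z - ∫ z, v w z ∂P‖ ^ 2 / σ ^ 2) ∂P ≤ 2) {X : Ω → Fin B → Z}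
    (hX : ∀ s, Measurable (fun ω => X ω s)) (hlaw : ∀ s, μ.map (fun ω => X ω s) = P)
    (hind : iIndepFun (fun s ω => X ω s) μ) :
    SubG (σ ^ 2 / B) (fun ω => batchMean v w (X ω) - ∫ z, v w z ∂P) μ := by
  have hvw : Measurable (v w) := hv.comp measurable_prodMk_left
  have hm : Measurable (fun z => v w z - ∫ z, v w z ∂P) := hvw.sub_const _
  have h1 : SubG (σ ^ 2) (fun z => v w z - ∫ z, v w z ∂P) P := by
    refine subG_of_exp_sq (hint.sub (integrable_const _)) ?_ hσ hexp
    have := integral_sub hint (integrable_const (∫ z, v w z ∂P))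
    simp only [integral_const, probReal_univ, one_smul, sub_self] at this
    exact this
  have h2 := subG_sum (sq_nonneg σ) (Y := fun s ω => v w (X ω s) - ∫ z, v w z ∂P)
    (fun s => hm.comp (hX s)) (hind.comp (fun _ z => v w z - ∫ z, v w z ∂P) fun _ => hm)
    (fun s => h1.map hm (hX s) (hlaw s)) Finset.univ
  have hB0 : (0 : ℝ) < B := by exact_mod_cast hB
  have h3 := h2.smul (b := (B : ℝ)⁻¹) (by positivity)
  convert h3 using 1
  · rw [Finset.card_univ, Fintype.card_fin]; field_simp
  · ext1 ω
    rw [Finset.sum_sub_distrib, smul_sub, Finset.sum_const, Finset.card_univ, Fintype.card_fin,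
      ← Nat.cast_smul_eq_nsmul ℝ, smul_smul, inv_mul_cancel₀ hB0.ne', one_smul]
    rfl

/-- The cut-off outside `Θ` makes the bound hold at every `w`, as needed when `w` is an arbitrary
value of a past iterate. -/
theorem subG_noise (hB : 1 ≤ B) {V : Type*} [NormedAddCommGroup V]
    [InnerProductSpace ℝ V] [CompleteSpace V] [MeasurableSpace V] [BorelSpace V]
    [SecondCountableTopology V] {Θ : Set (Vec d)} {v : Vec d → Z → V}
    (hv : Measurable (fun x : Vec d × Z => v x.1 x.2)) {σ : ℝ} (hσ : 0 < σ)
    (hsub : ∀ w ∈ Θ, Integrable (v w) P ∧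
      ∫⁻ z, eexp (‖v w z - ∫ z, v w z ∂P‖ ^ 2 / σ ^ 2) ∂P ≤ 2)
    {X : Ω → Fin B → Z} (hX : ∀ s, Measurable (fun ω => X ω s))
    (hlaw : ∀ s, μ.map (fun ω => X ω s) = P) (hind : iIndepFun (fun s ω => X ω s) μ)
    (w : Vec d) : SubG (σ ^ 2 / B) (fun ω => noise Θ v P w (X ω)) μ := by
  by_cases hu : w ∈ Θ
  · simp only [noise, hu, if_true]
    exact subG_batchMean_sub hB hv (hsub w hu).1 hσ (hsub w hu).2 hX hlaw hind
  · simp only [noise, hu, if_false]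
    exact SubG.zero.mono le_rfl (by positivity)

/-- The noise is a martingale difference sequence: the local point at step `τ` depends on samples of
earlier steps only, and for each frozen value of it the fresh batch adds `σ² / B` to the constant.
-/
theorem subG_noiseSum {E : ℕ} (hB : 1 ≤ B) {Θ : Set (Vec d)} (hΘ : MeasurableSet Θ)
    {v : Vec d → Z → Vec d} (hv : Measurable (fun x : Vec d × Z => v x.1 x.2)) {σ : ℝ}
    (hσ : 0 < σ) (hsub : ∀ w ∈ Θ, Integrable (v w) P ∧
      ∫⁻ z, eexp (‖v w z - ∫ z, v w z ∂P‖ ^ 2 / σ ^ 2) ∂P ≤ 2)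
    {X : Ω → ℕ → Fin B → Z} (hX : ∀ t < E, ∀ s, Measurable (fun ω => X ω t s))
    (hlaw : ∀ t < E, ∀ s, μ.map (fun ω => X ω t s) = P)
    (hind : iIndepFun (fun (j : Fin E × Fin B) ω => X ω j.1 j.2) μ) (γ : ℝ) (w : Vec d) (τ : ℕ)
    (hτ : τ ≤ E) :
    SubG (τ * (σ ^ 2 / B)) (fun ω => noiseSum Θ v P γ w (X ω) τ) μ := by
  induction τ with
  | zero => simpa [noiseSum] using SubG.zero
  | succ τ ih =>
    have hτ' : τ < E := hτ
    have hXj : ∀ j : Fin E × Fin B, Measurable (fun ω => X ω j.1 j.2) :=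
      fun j => hX j.1 j.1.2 j.2
    set Y : Fin E × Fin B → Ω → Z := fun j ω => X ω j.1 j.2 with hYdef
    set S₁ : Set (Fin E × Fin B) := {j | (j.1 : ℕ) < τ}
    set S₂ : Set (Fin E × Fin B) := {j | (j.1 : ℕ) = τ}
    have hI : Indep (sigmaOf Y S₁) (sigmaOf Y S₂) μ := indep_sigmaOf hXj hind
      (Set.disjoint_left.2 fun j (h : (j.1 : ℕ) < τ) (h' : (j.1 : ℕ) = τ) => by omega)
    have hM₁ : ∀ t < τ, ∀ s, Measurable[sigmaOf Y S₁] (fun ω => X ω t s) := fun t ht s =>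
      measurable_sigmaOf (Y := Y) (S := S₁) (j := (⟨t, ht.trans hτ'⟩, s)) ht
    have hM₂ : ∀ s, Measurable[sigmaOf Y S₂] (fun ω => X ω τ s) := fun s =>
      measurable_sigmaOf (Y := Y) (S := S₂) (j := (⟨τ, hτ'⟩, s)) rfl
    have hN : Measurable[sigmaOf Y S₁] (fun ω => noiseSum Θ v P γ w (X ω) τ) :=
      @measurable_noiseSum d B Z _ Θ v P _ Ω (sigmaOf Y S₁) hΘ hv γ _
        (@measurable_const _ _ _ (sigmaOf Y S₁) w) X τ hM₁
    have hnoise : Measurable[(sigmaOf Y S₁).prod (sigmaOf Y S₂)]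
        (fun q : Ω × Ω => noise Θ v P (localIter v γ w (X q.1) τ) (X q.2 τ)) := by
      have hloc := @measurable_localIter d B Z _ Ω (sigmaOf Y S₁) v hv γ _
        (@measurable_const _ _ _ (sigmaOf Y S₁) w) X τ hM₁
      exact @measurable_noise d B Z _ Θ P _ (Ω × Ω) ((sigmaOf Y S₁).prod (sigmaOf Y S₂)) _ _ _ _ _ _ v
        hΘ hv _
        (hloc.comp (@measurable_fst _ _ (sigmaOf Y S₁) (sigmaOf Y S₂))) (fun q => X q.2 τ)
        (fun s => (hM₂ s).comp (@measurable_snd _ _ (sigmaOf Y S₁) (sigmaOf Y S₂)))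
    have hcond : ∀ u : Vec d, SubG (σ ^ 2 / B) (fun ω => noise Θ v P u (X ω τ)) μ :=
      subG_noise hB hv hσ hsub (hX τ hτ') (hlaw τ hτ')
        (hind.precomp (g := fun s : Fin B => ((⟨τ, hτ'⟩ : Fin E), s))
          (fun a b h => (Prod.ext_iff.1 h).2))
    have := SubG.add_of_indep (sigmaOf_le hXj) (sigmaOf_le hXj) hI
      (κ₁ := τ * (σ ^ 2 / B)) (κ₂ := σ ^ 2 / B) (by positivity) (by positivity) hN
      (Y := fun ω ω' => noise Θ v P (localIter v γ w (X ω) τ) (X ω' τ)) hnoise (ih hτ'.le)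
      (fun ω => hcond _)
    have e : ((τ + 1 : ℕ) : ℝ) * (σ ^ 2 / B) = τ * (σ ^ 2 / B) + σ ^ 2 / B := by push_cast; ring
    rw [e]
    simp only [noiseSum, Finset.sum_range_succ]
    exact this

end SubGNoise

/-! ### Softmax weights -/

theorem sum_exp_pos {n : ℕ} [NeZero n] (v : Fin n → ℝ) : 0 < ∑ j, Real.exp (v j) :=
  Finset.sum_pos (fun _ _ => Real.exp_pos _) Finset.univ_nonempty

theorem softmax_pos {n : ℕ} [NeZero n] (v : Fin n → ℝ) (i : Fin n) : 0 < softmax v i :=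
  div_pos (Real.exp_pos _) (sum_exp_pos v)

theorem sum_softmax {n : ℕ} [NeZero n] (v : Fin n → ℝ) : ∑ i, softmax v i = 1 := by
  unfold softmax
  rw [← Finset.sum_div, div_self (sum_exp_pos v).ne']

theorem activeWeight_nonneg {n d Bv : ℕ} [NeZero n] {Z : Type*} [MeasurableSpace Z]
    (p : Problem n d Z) (a : Params) (w : Vec d) (ξ : Fin n → Fin Bv → Z) (i : Fin n) :
    0 ≤ activeWeight p a w ξ i := by
  unfold activeWeight
  split_ifs <;> exact (softmax_pos _ _).le

theorem sum_activeWeight {n d Bv : ℕ} [NeZero n] {Z : Type*} [MeasurableSpace Z]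
    (p : Problem n d Z) (a : Params) (w : Vec d) (ξ : Fin n → Fin Bv → Z) :
    ∑ i, activeWeight p a w ξ i = 1 := by
  unfold activeWeight
  split_ifs <;> exact sum_softmax _

/-! ### The noise of one round -/

/-- The accumulated gradient noise of client `i` in a round that starts at `w`. -/
noncomputable def roundNoise {n d Bv Bg : ℕ} {Z : Type*} [MeasurableSpace Z] (p : Problem n d Z)
    (a : Params) (Θ : Set (Vec d)) (w : Vec d) (ξ : Fin n → Fin Bv → Z)
    (ζ : Fin n → ℕ → Fin Bg → Z) (i : Fin n) (τ : ℕ) : Vec d :=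
  noiseSum Θ (activeGrad p a w ξ i) (p.dist i) a.γ w (ζ i) τ

/-- The weighted average over the clients of a functional `Φ` of the starting point of the round
and of the gradient noise. -/
noncomputable def roundValue {n d Bv Bg E : ℕ} {Z : Type*} [MeasurableSpace Z] (p : Problem n d Z)
    (a : Params) (Θ : Set (Vec d)) (Φ : Vec d → (Fin (E + 1) → Vec d) → ℝ) (w : Vec d)
    (ξ : Fin n → Fin Bv → Z) (ζ : Fin n → ℕ → Fin Bg → Z) : ℝ :=
  ∑ i, activeWeight p a w ξ i * Φ w (fun τ => roundNoise p a Θ w ξ ζ i τ)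

section Measurability

variable {n d Bv Bg : ℕ} {Z : Type*} [MeasurableSpace Z] {p : Problem n d Z}
  (hp : p.IsMeasurable) (a : Params) {Ω : Type*} [MeasurableSpace Ω]
  {W : Ω → Vec d} (hW : Measurable W) {Ξ : Ω → Fin n → Fin Bv → Z}
  (hΞ : ∀ i s, Measurable (fun ω => Ξ ω i s))

include hp hW hΞ

theorem measurable_estF (i : Fin n) : Measurable (fun ω => estF p (W ω) (Ξ ω) i) :=
  measurable_batchMean (hp i).1 hW (hΞ i)

theorem measurable_estG (i : Fin n) : Measurable (fun ω => estG p (W ω) (Ξ ω) i) :=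
  measurable_batchMean (hp i).2.1 hW (hΞ i)

theorem measurable_softmax_estF (i : Fin n) :
    Measurable (fun ω => softmax (a.α • estF p (W ω) (Ξ ω)) i) := by
  have h := fun i => measurable_estF hp hW hΞ i
  simp only [softmax, Pi.smul_apply]
  exact Measurable.div (Real.measurable_exp.comp ((h i).const_smul a.α))
    (Finset.measurable_sum _ fun j _ => Real.measurable_exp.comp ((h j).const_smul a.α))

theorem measurable_softmax_estG (i : Fin n) :
    Measurable (fun ω => softmax (a.α • estG p (W ω) (Ξ ω)) i) := by
  have h := fun i => measurable_estG hp hW hΞ i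
  simp only [softmax, Pi.smul_apply]
  exact Measurable.div (Real.measurable_exp.comp ((h i).const_smul a.α))
    (Finset.measurable_sum _ fun j _ => Real.measurable_exp.comp ((h j).const_smul a.α))

theorem measurableSet_accepts : MeasurableSet {ω | Accepts p a (W ω) (Ξ ω)} :=
  measurableSet_le (Finset.measurable_sum _ fun i _ =>
    (measurable_softmax_estG hp a hW hΞ i).mul (measurable_estG hp hW hΞ i)) measurable_const

theorem measurable_activeWeight (i : Fin n) :
    Measurable (fun ω => activeWeight p a (W ω) (Ξ ω) i) := by
  unfold activeWeight
  exact Measurable.ite (measurableSet_accepts hp a hW hΞ) (measurable_softmax_estF hp a hW hΞ i)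
    (measurable_softmax_estG hp a hW hΞ i)

/-- The active oracle varies with `ω` only through the acceptance test, so the local point is one of
two measurable functions, selected by a measurable event. -/
theorem measurable_localPoint {ζ : Ω → Fin n → ℕ → Fin Bg → Z} (τ : ℕ)
    (hζ : ∀ i, ∀ t < τ, ∀ s, Measurable (fun ω => ζ ω i t s)) (i : Fin n) :
    Measurable (fun ω => localPoint p a (W ω) (Ξ ω) (ζ ω) i τ) := by
  classical
  have e : (fun ω => localPoint p a (W ω) (Ξ ω) (ζ ω) i τ) = fun ω =>
      if Accepts p a (W ω) (Ξ ω) then localIter (p.gradf i) a.γ (W ω) (ζ ω i) τ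
        else localIter (p.gradg i) a.γ (W ω) (ζ ω i) τ := by
    ext1 ω
    unfold localPoint activeGrad
    split_ifs <;> rfl
  rw [e]
  exact Measurable.ite (measurableSet_accepts hp a hW hΞ)
    (measurable_localIter (hp i).2.2.1 _ hW τ (hζ i))
    (measurable_localIter (hp i).2.2.2 _ hW τ (hζ i))

theorem measurable_roundNoise (hdist : ∀ i, IsProbabilityMeasure (p.dist i)) {Θ : Set (Vec d)}
    (hΘ : MeasurableSet Θ) {ζ : Ω → Fin n → ℕ → Fin Bg → Z} (τ : ℕ)
    (hζ : ∀ i, ∀ t < τ, ∀ s, Measurable (fun ω => ζ ω i t s)) (i : Fin n) :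
    Measurable (fun ω => roundNoise p a Θ (W ω) (Ξ ω) (ζ ω) i τ) := by
  classical
  have e : (fun ω => roundNoise p a Θ (W ω) (Ξ ω) (ζ ω) i τ) = fun ω =>
      if Accepts p a (W ω) (Ξ ω) then noiseSum Θ (p.gradf i) (p.dist i) a.γ (W ω) (ζ ω i) τ
        else noiseSum Θ (p.gradg i) (p.dist i) a.γ (W ω) (ζ ω i) τ := by
    ext1 ω
    unfold roundNoise activeGrad
    split_ifs <;> rfl
  rw [e]
  exact Measurable.ite (measurableSet_accepts hp a hW hΞ)
    (measurable_noiseSum hΘ (hp i).2.2.1 _ hW τ (hζ i))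
    (measurable_noiseSum hΘ (hp i).2.2.2 _ hW τ (hζ i))

theorem measurable_roundValue (hdist : ∀ i, IsProbabilityMeasure (p.dist i)) {Θ : Set (Vec d)}
    (hΘ : MeasurableSet Θ) {E : ℕ} {ζ : Ω → Fin n → ℕ → Fin Bg → Z}
    (hζ : ∀ i, ∀ t < E, ∀ s, Measurable (fun ω => ζ ω i t s))
    {Φ : Vec d → (Fin (E + 1) → Vec d) → ℝ}
    (hΦ : Measurable (fun q : Vec d × (Fin (E + 1) → Vec d) => Φ q.1 q.2)) :
    Measurable (fun ω => roundValue p a Θ Φ (W ω) (Ξ ω) (ζ ω)) := by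
  unfold roundValue
  refine Finset.measurable_sum _ fun i _ => (measurable_activeWeight hp a hW hΞ i).mul ?_
  exact hΦ.comp (hW.prodMk (measurable_pi_lambda _ fun τ =>
    measurable_roundNoise hp a hW hΞ hdist hΘ τ
      (fun i t ht => hζ i t (ht.trans_le (Nat.lt_succ_iff.1 τ.2))) i))

omit hW hΞ in
theorem measurable_globalIter (w₀ : Vec d) {X : Ω → Samples n Bv Bg Z} (k : ℕ)
    (hξ : ∀ j < k, ∀ i s, Measurable (fun ω => (X ω).ξ j i s))
    (hζ : ∀ j < k, ∀ i, ∀ t < a.E, ∀ s, Measurable (fun ω => (X ω).ζ j i t s)) :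
    Measurable (fun ω => globalIter p a w₀ (X ω) k) := by
  induction k with
  | zero => exact measurable_const
  | succ k ih =>
    have h := ih (fun j hj => hξ j (hj.trans k.lt_succ_self))
      (fun j hj => hζ j (hj.trans k.lt_succ_self))
    have hξk := hξ k k.lt_succ_self
    have hζk := hζ k k.lt_succ_self
    have hsum : Measurable (fun ω => ∑ i, activeWeight p a (globalIter p a w₀ (X ω) k)
        ((X ω).ξ k) i • localDirection p a (globalIter p a w₀ (X ω) k) ((X ω).ξ k)
          ((X ω).ζ k) i) := by
      refine Finset.measurable_sum _ fun i _ => ?_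
      have hdiff : Measurable (fun ω =>
          localPoint p a (globalIter p a w₀ (X ω) k) ((X ω).ξ k) ((X ω).ζ k) i 0 -
          localPoint p a (globalIter p a w₀ (X ω) k) ((X ω).ξ k) ((X ω).ζ k) i a.E) :=
        (measurable_localPoint hp a h hξk 0 (fun _ t ht => absurd ht t.not_lt_zero) i).sub
          (measurable_localPoint hp a h hξk a.E hζk i)
      have hdir : Measurable (fun ω => localDirection p a (globalIter p a w₀ (X ω) k)
          ((X ω).ξ k) ((X ω).ζ k) i) := by
        unfold localDirection
        exact hdiff.const_smul (a.γ * a.E)⁻¹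
      exact (measurable_activeWeight hp a h hξk i).smul hdir
    exact h.sub (hsum.const_smul a.η)

end Measurability

/-! ### The samples as an independent family -/

/-- Indices of the samples used in `K` rounds with `E` local steps. -/
abbrev SampleIdx (K n E Bv Bg : ℕ) : Type :=
  (Fin K × Fin n × Fin Bv) ⊕ (Fin K × Fin n × Fin E × Fin Bg)

/-- The samples as a single family of random variables. -/
def sampleVar {n Bv Bg K E : ℕ} {Z Ω : Type*} (X : Ω → Samples n Bv Bg Z) :
    SampleIdx K n E Bv Bg → Ω → Z
  | .inl (k, i, s) => fun ω => (X ω).ξ k i s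
  | .inr (k, i, τ, s) => fun ω => (X ω).ζ k i τ s

/-- The round in which a sample is drawn. -/
def roundOf {n Bv Bg K E : ℕ} : SampleIdx K n E Bv Bg → ℕ
  | .inl (k, _, _) => k
  | .inr (k, _, _, _) => k

section SampleMeasurability

variable {n d Bv Bg K E : ℕ} {Z : Type*} [MeasurableSpace Z] {p : Problem n d Z}
  {Ω : Type*} {X : Ω → Samples n Bv Bg Z}

theorem measurable_ξ_sigmaOf {S : Set (SampleIdx K n E Bv Bg)} {k : ℕ} (hk : k < K)
    (hS : ∀ i s, Sum.inl (⟨k, hk⟩, i, s) ∈ S) (i : Fin n) (s : Fin Bv) :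
    Measurable[sigmaOf (sampleVar X) S] (fun ω => (X ω).ξ k i s) :=
  measurable_sigmaOf (Y := sampleVar X) (hS i s)

theorem measurable_ζ_sigmaOf {S : Set (SampleIdx K n E Bv Bg)} {k : ℕ} (hk : k < K)
    (hS : ∀ i τ s, Sum.inr (⟨k, hk⟩, i, τ, s) ∈ S) (i : Fin n) (t : ℕ) (ht : t < E) (s : Fin Bg) :
    Measurable[sigmaOf (sampleVar X) S] (fun ω => (X ω).ζ k i t s) :=
  measurable_sigmaOf (Y := sampleVar X) (hS i ⟨t, ht⟩ s)

theorem measurable_globalIter_past (hp : p.IsMeasurable) (a : Params) (haE : a.E = E)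
    (w₀ : Vec d) {j k : ℕ} (hjk : j ≤ k) (hk : k ≤ K) :
    Measurable[sigmaOf (sampleVar X) {j : SampleIdx K n E Bv Bg | roundOf j < k}]
      (fun ω => globalIter p a w₀ (X ω) j) := by
  subst haE
  exact @measurable_globalIter n d Bv Bg Z _ p hp a Ω (sigmaOf (sampleVar X) _) w₀ X j
    (fun l hl => measurable_ξ_sigmaOf (by omega) fun i s => by
      simp only [Set.mem_ofPred_eq, roundOf]; omega)
    (fun l hl => measurable_ζ_sigmaOf (by omega) fun i τ s => by
      simp only [Set.mem_ofPred_eq, roundOf]; omega)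

end SampleMeasurability

/-! ### Exponential moments of the noise, first in one round and then over all rounds. -/

section Sampling

variable {n d Bv Bg K E : ℕ} {Z : Type*} [MeasurableSpace Z] {p : Problem n d Z}
  {Ω : Type*} [mΩ : MeasurableSpace Ω] {μ : Measure Ω}
  {X : Ω → Samples n Bv Bg Z}

theorem IsSampling.measurable_sampleVar (hX : IsSampling μ p K E X)
    (j : SampleIdx K n E Bv Bg) : Measurable (sampleVar X j) := by
  rcases j with ⟨k, i, s⟩ | ⟨k, i, τ, s⟩
  · exact (hX.1 k k.2 i s).1
  · exact (hX.2.1 k k.2 i τ τ.2 s).1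

theorem IsSampling.iIndepFun_sampleVar (hX : IsSampling μ p K E X) :
    iIndepFun (sampleVar X : SampleIdx K n E Bv Bg → Ω → Z) μ := by
  convert hX.2.2 using 1
  funext j ω
  rcases j with ⟨k, i, s⟩ | ⟨k, i, τ, s⟩ <;> rfl

/-- The rounds before `k` are independent of round `k`. -/
theorem IsSampling.indep_past (hX : IsSampling μ p K E X) (k : ℕ) :
    Indep (sigmaOf (sampleVar X) {j : SampleIdx K n E Bv Bg | roundOf j < k})
      (sigmaOf (sampleVar X) {j : SampleIdx K n E Bv Bg | roundOf j = k}) μ :=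
  indep_sigmaOf hX.measurable_sampleVar hX.iIndepFun_sampleVar
    (Set.disjoint_left.2 fun _ h h' => (lt_irrefl k) (h' ▸ h))

variable [IsProbabilityMeasure μ]

/-- With `w` and `ξ` frozen, the active oracle is a fixed one of two. The constant of a full round
of `E` steps is used for every `τ ≤ E`, so that a single constant enters the functionals of the
noise. -/
theorem subG_roundNoise (hBg : 1 ≤ Bg) (hp : p.IsMeasurable)
    (hdist : ∀ i, IsProbabilityMeasure (p.dist i)) {Θ : Set (Vec d)} (hΘ : MeasurableSet Θ)
    {σ : ℝ} (hσ : 0 < σ) (hsubf : SubGaussianGradients p.dist Θ σ p.f p.gradf)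
    (hsubg : SubGaussianGradients p.dist Θ σ p.g p.gradg) (a : Params)
    (hX : IsSampling μ p K E X) {k : ℕ} (hk : k < K) (w : Vec d) (ξ : Fin n → Fin Bv → Z)
    (i : Fin n) {τ : ℕ} (hτ : τ ≤ E) :
    SubG (E * (σ ^ 2 / Bg)) (fun ω => roundNoise p a Θ w ξ ((X ω).ζ k) i τ) μ := by
  have hmain : ∀ v : Vec d → Z → Vec d, Measurable (fun x : Vec d × Z => v x.1 x.2) →
      (∀ w ∈ Θ, Integrable (v w) (p.dist i) ∧
        ∫⁻ z, eexp (‖v w z - ∫ z, v w z ∂(p.dist i)‖ ^ 2 / σ ^ 2) ∂(p.dist i) ≤ 2) →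
      SubG (E * (σ ^ 2 / Bg))
        (fun ω => noiseSum Θ v (p.dist i) a.γ w ((X ω).ζ k i) τ) μ := by
    intro v hv hsub
    refine (subG_noiseSum (E := E) hBg hΘ hv hσ hsub
      (fun t ht s => (hX.2.1 k hk i t ht s).1) (fun t ht s => (hX.2.1 k hk i t ht s).2)
      ?_ a.γ w τ hτ).mono (by positivity) (by gcongr)
    exact hX.iIndepFun_sampleVar.precomp
      (g := fun j : Fin E × Fin Bg => Sum.inr ((⟨k, hk⟩ : Fin K), i, j.1, j.2)) (by
        rintro ⟨t, s⟩ ⟨t', s'⟩ h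
        simpa using h)
  unfold roundNoise activeGrad
  split_ifs
  · exact hmain _ (hp i).2.2.1 fun w hw => ⟨(hsubf i w hw).1, (hsubf i w hw).2.2⟩
  · exact hmain _ (hp i).2.2.2 fun w hw => ⟨(hsubg i w hw).1, (hsubg i w hw).2.2⟩

/-- Exponential moments of the contribution of one round with a fixed starting point and fixed
samples of function values. -/
theorem lintegral_eexp_roundValue_le_of_fixed [NeZero n] (hBg : 1 ≤ Bg) (hp : p.IsMeasurable)
    (hdist : ∀ i, IsProbabilityMeasure (p.dist i)) {Θ : Set (Vec d)} (hΘ : MeasurableSet Θ)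
    {σ : ℝ} (hσ : 0 < σ) (hsubf : SubGaussianGradients p.dist Θ σ p.f p.gradf)
    (hsubg : SubGaussianGradients p.dist Θ σ p.g p.gradg) (a : Params)
    (hX : IsSampling μ p K E X) {Φ : Vec d → (Fin (E + 1) → Vec d) → ℝ}
    (hΦ : Measurable (fun q : Vec d × (Fin (E + 1) → Vec d) => Φ q.1 q.2)) {C : ℝ}
    (hC : ∀ (w : Vec d) (N : Ω → Fin (E + 1) → Vec d), (∀ τ, Measurable fun ω => N ω τ) →
      (∀ τ, SubG (E * (σ ^ 2 / Bg)) (fun ω => N ω τ) μ) → ∫⁻ ω, eexp (Φ w (N ω)) ∂μ ≤ eexp C)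
    {k : ℕ} (hk : k < K) (w : Vec d) (ξ : Fin n → Fin Bv → Z) :
    ∫⁻ ω, eexp (roundValue p a Θ Φ w ξ ((X ω).ζ k)) ∂μ ≤ eexp C := by
  have hNm : ∀ (i : Fin n), ∀ τ ≤ E,
      Measurable (fun ω => roundNoise p a Θ w ξ ((X ω).ζ k) i τ) := fun i τ hτ =>
    measurable_roundNoise hp a (W := fun _ : Ω => w) measurable_const (Ξ := fun _ : Ω => ξ)
      (fun _ _ => measurable_const) hdist hΘ (ζ := fun ω => (X ω).ζ k) τ
      (fun i t ht s => (hX.2.1 k hk i t (ht.trans_le hτ) s).1) i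
  set N : Fin n → Ω → Fin (E + 1) → Vec d := fun i ω τ =>
    roundNoise p a Θ w ξ ((X ω).ζ k) i τ with hN
  have hNm' : ∀ i τ, Measurable fun ω => N i ω τ := fun i τ => hNm i τ (Nat.lt_succ_iff.1 τ.2)
  have hNs : ∀ i τ, SubG (E * (σ ^ 2 / Bg)) (fun ω => N i ω τ) μ := fun i τ =>
    subG_roundNoise hBg hp hdist hΘ hσ hsubf hsubg a hX hk w ξ i (Nat.lt_succ_iff.1 τ.2)
  have hm : ∀ i, Measurable fun ω => eexp (Φ w (N i ω)) := fun i =>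
    measurable_eexp.comp (hΦ.comp (measurable_const.prodMk (measurable_pi_lambda _ (hNm' i))))
  have hr0 : ∀ i ∈ Finset.univ, 0 ≤ activeWeight p a w ξ i := fun i _ =>
    activeWeight_nonneg p a w ξ i
  -- Jensen over the clients: the weights are deterministic here and sum to one, so each client's
  -- own bound suffices and `n` does not appear.
  have hle : ∀ ω, eexp (roundValue p a Θ Φ w ξ ((X ω).ζ k)) ≤
      ∑ i, ENNReal.ofReal (activeWeight p a w ξ i) * eexp (Φ w (N i ω)) := fun ω =>
    eexp_sum_le Finset.univ _ (fun i => Φ w (N i ω)) hr0 (sum_activeWeight _ _ _ _)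
  refine (lintegral_mono hle).trans ?_
  rw [lintegral_finsetSum _ (fun i _ => (hm i).const_mul _)]
  have hle2 : ∀ i ∈ Finset.univ, ∫⁻ ω, ENNReal.ofReal (activeWeight p a w ξ i) *
      eexp (Φ w (N i ω)) ∂μ ≤ ENNReal.ofReal (activeWeight p a w ξ i) * eexp C := by
    intro i _
    rw [lintegral_const_mul _ (hm i)]
    exact mul_le_mul_right (hC w (N i) (hNm' i) (hNs i)) _
  refine (Finset.sum_le_sum hle2).trans (le_of_eq ?_)
  rw [← Finset.sum_mul, ← ENNReal.ofReal_sum_of_nonneg hr0, sum_activeWeight]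
  simp

/-- Exponential moments of the contribution of one round that starts at a fixed point. -/
theorem lintegral_eexp_roundValue_le [NeZero n] (hBg : 1 ≤ Bg) (hp : p.IsMeasurable)
    (hdist : ∀ i, IsProbabilityMeasure (p.dist i)) {Θ : Set (Vec d)} (hΘ : MeasurableSet Θ)
    {σ : ℝ} (hσ : 0 < σ) (hsubf : SubGaussianGradients p.dist Θ σ p.f p.gradf)
    (hsubg : SubGaussianGradients p.dist Θ σ p.g p.gradg) (a : Params)
    (hX : IsSampling μ p K E X) {Φ : Vec d → (Fin (E + 1) → Vec d) → ℝ}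
    (hΦ : Measurable (fun q : Vec d × (Fin (E + 1) → Vec d) => Φ q.1 q.2)) {C : ℝ}
    (hC : ∀ (w : Vec d) (N : Ω → Fin (E + 1) → Vec d), (∀ τ, Measurable fun ω => N ω τ) →
      (∀ τ, SubG (E * (σ ^ 2 / Bg)) (fun ω => N ω τ) μ) → ∫⁻ ω, eexp (Φ w (N ω)) ∂μ ≤ eexp C)
    {k : ℕ} (hk : k < K) (w : Vec d) :
    ∫⁻ ω, eexp (roundValue p a Θ Φ w ((X ω).ξ k) ((X ω).ζ k)) ∂μ ≤ eexp C := by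
  -- The weights and the choice of oracle depend on the samples of function values, which are
  -- independent of the gradient samples. The bound for frozen `ξ` is uniform in `ξ`, so it survives
  -- integration.
  have hI : Indep
      (sigmaOf (sampleVar X) {j : SampleIdx K n E Bv Bg | ∃ x, j = Sum.inl x})
      (sigmaOf (sampleVar X) {j : SampleIdx K n E Bv Bg | ∃ x, j = Sum.inr x}) μ :=
    indep_sigmaOf hX.measurable_sampleVar hX.iIndepFun_sampleVar
      (Set.disjoint_left.2 (by rintro j ⟨x, rfl⟩ ⟨y, hy⟩; cases hy))
  have hξ : ∀ i s, Measurable[sigmaOf (sampleVar X)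
      {j : SampleIdx K n E Bv Bg | ∃ x, j = Sum.inl x}] (fun ω => (X ω).ξ k i s) :=
    measurable_ξ_sigmaOf hk fun i s => ⟨_, rfl⟩
  have hζ : ∀ i, ∀ t < E, ∀ s, Measurable[sigmaOf (sampleVar X)
      {j : SampleIdx K n E Bv Bg | ∃ x, j = Sum.inr x}] (fun ω => (X ω).ζ k i t s) :=
    measurable_ζ_sigmaOf hk fun i τ s => ⟨_, rfl⟩
  have hφ := @measurable_roundValue n d Bv Bg Z _ p hp a (Ω × Ω)
      (MeasurableSpace.prod _ _) _ (@measurable_const _ _ _ _ w)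
      (fun q => (X q.1).ξ k) (fun i s => (hξ i s).comp (@measurable_fst _ _ _ _)) hdist Θ hΘ E
      (fun q => (X q.2).ζ k) (fun i t ht s => (hζ i t ht s).comp (@measurable_snd _ _ _ _)) Φ hΦ
  have h := lintegral_diag_le_of_indep (sigmaOf_le hX.measurable_sampleVar)
    (sigmaOf_le hX.measurable_sampleVar) hI
    (φ := fun ω ω' => eexp (roundValue p a Θ Φ w ((X ω).ξ k) ((X ω').ζ k)))
    (measurable_eexp.comp hφ) (ψ := fun _ => eexp C) (fun ω =>
      lintegral_eexp_roundValue_le_of_fixed hBg hp hdist hΘ hσ hsubf hsubg a hX hΦ hC hk w _)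
  simpa using h

/-- Exponential moments of the sum of the contributions of all rounds. -/
theorem lintegral_eexp_sum_roundValue_le [NeZero n] (hBg : 1 ≤ Bg) (hp : p.IsMeasurable)
    (hdist : ∀ i, IsProbabilityMeasure (p.dist i)) {Θ : Set (Vec d)} (hΘ : MeasurableSet Θ)
    {σ : ℝ} (hσ : 0 < σ) (hsubf : SubGaussianGradients p.dist Θ σ p.f p.gradf)
    (hsubg : SubGaussianGradients p.dist Θ σ p.g p.gradg) (a : Params) (haE : a.E = E)
    (hX : IsSampling μ p K E X) {Φ : Vec d → (Fin (E + 1) → Vec d) → ℝ}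
    (hΦ : Measurable (fun q : Vec d × (Fin (E + 1) → Vec d) => Φ q.1 q.2)) {C : ℝ}
    (hC : ∀ (w : Vec d) (N : Ω → Fin (E + 1) → Vec d), (∀ τ, Measurable fun ω => N ω τ) →
      (∀ τ, SubG (E * (σ ^ 2 / Bg)) (fun ω => N ω τ) μ) → ∫⁻ ω, eexp (Φ w (N ω)) ∂μ ≤ eexp C)
    (w₀ : Vec d) (k : ℕ) (hk : k ≤ K) :
    ∫⁻ ω, eexp (∑ j ∈ Finset.range k, roundValue p a Θ Φ (globalIter p a w₀ (X ω) j)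
      ((X ω).ξ j) ((X ω).ζ j)) ∂μ ≤ eexp (k * C) := by
  induction k with
  | zero => simp [eexp_zero]
  | succ k ih =>
    have hk' : k < K := hk
    have hξ : ∀ i s, Measurable[sigmaOf (sampleVar X)
        {j : SampleIdx K n E Bv Bg | roundOf j = k}] (fun ω => (X ω).ξ k i s) :=
      measurable_ξ_sigmaOf hk' fun i s => rfl
    have hζ : ∀ i, ∀ t < E, ∀ s, Measurable[sigmaOf (sampleVar X)
        {j : SampleIdx K n E Bv Bg | roundOf j = k}] (fun ω => (X ω).ζ k i t s) :=
      measurable_ζ_sigmaOf hk' fun i τ s => rfl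
    have hw := measurable_globalIter_past (X := X) (Bv := Bv) (Bg := Bg) hp a haE w₀ le_rfl hk'.le
    have hφ : Measurable[(sigmaOf (sampleVar X) {j : SampleIdx K n E Bv Bg | roundOf j < k}).prod
        (sigmaOf (sampleVar X) {j : SampleIdx K n E Bv Bg | roundOf j = k})]
        (fun q : Ω × Ω => roundValue p a Θ Φ (globalIter p a w₀ (X q.1) k)
          ((X q.2).ξ k) ((X q.2).ζ k)) :=
      @measurable_roundValue n d Bv Bg Z _ p hp a (Ω × Ω) (MeasurableSpace.prod _ _) _
        (hw.comp (@measurable_fst _ _ _ _)) (fun q => (X q.2).ξ k)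
        (fun i s => (hξ i s).comp (@measurable_snd _ _ _ _)) hdist Θ hΘ E
        (fun q => (X q.2).ζ k) (fun i t ht s => (hζ i t ht s).comp (@measurable_snd _ _ _ _)) Φ hΦ
    have hS : Measurable[sigmaOf (sampleVar X) {j : SampleIdx K n E Bv Bg | roundOf j < k}]
        (fun ω => ∑ j ∈ Finset.range k, roundValue p a Θ Φ (globalIter p a w₀ (X ω) j)
          ((X ω).ξ j) ((X ω).ζ j)) := by
      refine @Finset.measurable_sum _ _ _ _ _ _ (sigmaOf (sampleVar X) _) _ _ fun j hj => ?_
      have hj' := Finset.mem_range.1 hj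
      refine @measurable_roundValue n d Bv Bg Z _ p hp a Ω (sigmaOf (sampleVar X) _) _
        (measurable_globalIter_past (X := X) (Bv := Bv) (Bg := Bg) hp a haE w₀ hj'.le hk'.le)
        _ ?_ hdist Θ hΘ E _ ?_ Φ hΦ
      · exact measurable_ξ_sigmaOf (hj'.trans hk') fun i s => hj'
      · exact measurable_ζ_sigmaOf (hj'.trans hk') fun i τ s => hj'
    -- Round `k` starts at a function of the earlier rounds. The one-round bound is uniform in the
    -- starting point, so each round contributes one more factor `exp C`.
    have := lintegral_eexp_add_le_of_indep (sigmaOf_le hX.measurable_sampleVar)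
      (sigmaOf_le hX.measurable_sampleVar) (hX.indep_past k) hS
      (φ := fun ω ω' => roundValue p a Θ Φ (globalIter p a w₀ (X ω) k)
        ((X ω').ξ k) ((X ω').ζ k)) hφ (ih hk'.le) (C' := C)
      (fun ω => lintegral_eexp_roundValue_le hBg hp hdist hΘ hσ hsubf hsubg a hX hΦ hC hk' _)
    simp only [Finset.sum_range_succ]
    refine this.trans (le_of_eq ?_)
    push_cast; ring_nf

/-- The batch errors of function values at the global iterates are sub-Gaussian. -/
theorem subG_noise_globalIter (hBv : 1 ≤ Bv) (hp : p.IsMeasurable)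
    (hdist : ∀ i, IsProbabilityMeasure (p.dist i)) {Θ : Set (Vec d)} (hΘ : MeasurableSet Θ)
    {σ : ℝ} (hσ : 0 < σ) (a : Params) (haE : a.E = E) (hX : IsSampling μ p K E X) (w₀ : Vec d)
    {h : Fin n → Vec d → Z → ℝ} (hh : ∀ i, Measurable (fun x : Vec d × Z => h i x.1 x.2))
    (hsub : SubGaussianEstimates p.dist Θ σ h) {k : ℕ} (hk : k < K) (i : Fin n) :
    Measurable (fun ω => noise Θ (h i) (p.dist i) (globalIter p a w₀ (X ω) k) ((X ω).ξ k i)) ∧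
    SubG (σ ^ 2 / Bv)
      (fun ω => noise Θ (h i) (p.dist i) (globalIter p a w₀ (X ω) k) ((X ω).ξ k i)) μ := by
  have hξ : ∀ s, Measurable[sigmaOf (sampleVar X)
      {j : SampleIdx K n E Bv Bg | roundOf j = k}] (fun ω => (X ω).ξ k i s) :=
    measurable_ξ_sigmaOf hk (fun i s => rfl) i
  have hw := measurable_globalIter_past (X := X) (Bv := Bv) (Bg := Bg) hp a haE w₀ le_rfl hk.le
  have hY : Measurable[(sigmaOf (sampleVar X) {j : SampleIdx K n E Bv Bg | roundOf j < k}).prod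
      (sigmaOf (sampleVar X) {j : SampleIdx K n E Bv Bg | roundOf j = k})]
      (fun q : Ω × Ω => noise Θ (h i) (p.dist i) (globalIter p a w₀ (X q.1) k)
        ((X q.2).ξ k i)) :=
    @measurable_noise d Bv Z _ Θ (p.dist i) _ (Ω × Ω) (MeasurableSpace.prod _ _) _ _ _ _ _ _ (h i)
      hΘ (hh i) _ (hw.comp (@measurable_fst _ _ _ _)) _
      (fun s => (hξ s).comp (@measurable_snd _ _ _ _))
  refine ⟨measurable_noise hΘ (hh i) (hw.mono (sigmaOf_le hX.measurable_sampleVar) le_rfl)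
    fun s => (hX.1 k hk i s).1, ?_⟩
  -- Adding the conditionally sub-Gaussian error to the zero variable, which has constant zero,
  -- removes the conditioning on the past.
  have := SubG.add_of_indep (sigmaOf_le hX.measurable_sampleVar)
    (sigmaOf_le hX.measurable_sampleVar) (hX.indep_past k) (κ₁ := 0) (κ₂ := σ ^ 2 / Bv) le_rfl
    (by positivity) (N := fun _ => (0 : ℝ)) (@measurable_const _ _ _ _ _)
    (Y := fun ω ω' => noise Θ (h i) (p.dist i) (globalIter p a w₀ (X ω) k) ((X ω').ξ k i)) hY
    SubG.zero (fun ω => subG_noise hBv (hh i) hσ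
      (fun w hw => ⟨(hsub i w hw).1, by
        have := (hsub i w hw).2
        simp only [Real.norm_eq_abs, sq_abs]
        exact this⟩)
      (fun s => (hX.1 k hk i s).1) (fun s => (hX.1 k hk i s).2)
      (hX.iIndepFun_sampleVar.precomp (g := fun s : Fin Bv => Sum.inl ((⟨k, hk⟩ : Fin K), i, s))
        (by intro s s' h; simpa using h)) _)
  simpa using this

end Sampling

/-! ### Tail bounds -/

/-- Chernoff's method: `u = t / (2κ)` minimizes `κ u² - u t`, with value `-t² / (4κ)`. The auxiliary
bound depends on `u` through `u²` only and so serves both signs. -/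
theorem SubG.measure_abs_ge_le {Ω : Type*} {m : MeasurableSpace Ω} {μ : Measure Ω} {κ : ℝ}
    (hκ : 0 < κ) {Y : Ω → ℝ} (h : SubG κ Y μ) (hY : Measurable Y) {t : ℝ} (ht : 0 ≤ t) :
    μ {ω | t ≤ |Y ω|} ≤ 2 * eexp (-(t ^ 2 / (4 * κ))) := by
  have hside : ∀ u : ℝ, u ^ 2 = (t / (2 * κ)) ^ 2 →
      μ {ω | t * (t / (2 * κ)) ≤ u * Y ω} ≤ eexp (-(t ^ 2 / (4 * κ))) := by
    intro u hu
    have h1 := h.1 u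
    have e : ∀ ω, inner ℝ u (Y ω) = u * Y ω := fun ω => by simp [mul_comm]
    simp only [e, Real.norm_eq_abs, sq_abs, hu] at h1
    refine (measure_ge_le_eexp h1 (hY.const_mul u) _).trans (eexp_mono (le_of_eq ?_))
    field_simp; ring
  have hq : 0 ≤ t / (2 * κ) := by positivity
  have hsub : {ω | t ≤ |Y ω|} ⊆ {ω | t * (t / (2 * κ)) ≤ t / (2 * κ) * Y ω} ∪
      {ω | t * (t / (2 * κ)) ≤ -(t / (2 * κ)) * Y ω} := by
    intro ω hω
    rcases le_abs.1 (show t ≤ |Y ω| from hω) with h | h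
    · left; simp only [Set.mem_ofPred_eq]; nlinarith
    · right; simp only [Set.mem_ofPred_eq]; nlinarith
  refine (measure_mono hsub).trans ((measure_union_le _ _).trans ?_)
  rw [two_mul (eexp _)]
  exact add_le_add (hside _ rfl) (hside _ (neg_sq _))

/-! ### Functionals of the gradient noise -/

/-- The inner product of the final gradient noise with `c (y - w)`, zero outside `Θ`. -/
noncomputable def linearFunctional {d E : ℕ} (Θ : Set (Vec d)) (c : ℝ) (y w : Vec d)
    (N : Fin (E + 1) → Vec d) : ℝ :=
  open Classical in inner ℝ (if w ∈ Θ then c • (y - w) else 0) (N (Fin.last E))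

/-- Weights on the local steps: one half for the last one, and one half spread evenly over the
others. -/
noncomputable def stepWeight {E : ℕ} (τ : Fin (E + 1)) : ℝ :=
  if τ = Fin.last E then 1 / 2 else 1 / (2 * E)

/-- The weighted average of the squared norms of the gradient noise, divided by `c`. -/
noncomputable def squareFunctional {d E : ℕ} (c : ℝ) (_w : Vec d) (N : Fin (E + 1) → Vec d) : ℝ :=
  ∑ τ, stepWeight τ * (‖N τ‖ ^ 2 / c)

theorem stepWeight_nonneg {E : ℕ} (τ : Fin (E + 1)) : 0 ≤ stepWeight τ := by
  unfold stepWeight; split_ifs <;> positivity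

theorem sum_stepWeight_mul {E : ℕ} (x : ℕ → ℝ) :
    ∑ τ : Fin (E + 1), stepWeight τ * x τ
      = (∑ τ ∈ Finset.range E, x τ) / (2 * E) + x E / 2 := by
  rw [Fin.sum_univ_castSucc, Finset.sum_range, Finset.sum_div]
  congr 1
  · refine Finset.sum_congr rfl fun τ _ => ?_
    simp only [stepWeight, (Fin.castSucc_lt_last τ).ne, if_false, Fin.val_castSucc]
    ring
  · simp only [stepWeight, if_true, Fin.val_last]
    ring

theorem sum_stepWeight {E : ℕ} (hE : 1 ≤ E) : ∑ τ : Fin (E + 1), stepWeight τ = 1 := by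
  have h := sum_stepWeight_mul (E := E) (fun _ => 1)
  have hE0 : (E : ℝ) ≠ 0 := by positivity
  simp only [mul_one, Finset.sum_const, Finset.card_range, nsmul_eq_mul] at h
  rw [h]; field_simp; norm_num

theorem measurable_linearFunctional {d E : ℕ} {Θ : Set (Vec d)} (hΘ : MeasurableSet Θ) (c : ℝ)
    (y : Vec d) : Measurable (fun q : Vec d × (Fin (E + 1) → Vec d) =>
      linearFunctional Θ c y q.1 q.2) := by
  unfold linearFunctional
  refine Measurable.inner (Measurable.ite (measurable_fst hΘ) (by fun_prop) measurable_const) ?_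
  fun_prop

theorem measurable_squareFunctional {d E : ℕ} (c : ℝ) :
    Measurable (fun q : Vec d × (Fin (E + 1) → Vec d) => squareFunctional c q.1 q.2) := by
  unfold squareFunctional
  fun_prop

section Functional

variable {d E : ℕ} {Ω : Type*} {m : MeasurableSpace Ω} {μ : Measure Ω}

/-- This is the moment generating function in the direction `c (y - w)`; the cut-off keeps its
length at most `|c| D` for every `w`. -/
theorem lintegral_eexp_linearFunctional_le {Θ : Set (Vec d)} {D : ℝ} {y : Vec d}
    (hy : ∀ w ∈ Θ, ‖y - w‖ ≤ D) {κ : ℝ} (hκ : 0 ≤ κ) (c : ℝ)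
    (w : Vec d) {N : Ω → Fin (E + 1) → Vec d} (hN : ∀ τ, SubG κ (fun ω => N ω τ) μ) :
    ∫⁻ ω, eexp (linearFunctional Θ c y w (N ω)) ∂μ ≤ eexp (κ * (c ^ 2 * D ^ 2)) := by
  unfold linearFunctional
  refine ((hN (Fin.last E)).1 _).trans (eexp_mono (mul_le_mul_of_nonneg_left ?_ hκ))
  split_ifs with hw
  · rw [norm_smul, mul_pow, Real.norm_eq_abs, sq_abs]
    have := hy w hw
    gcongr
  · simp only [norm_zero, ne_eq, OfNat.ofNat_ne_zero, not_false_eq_true, zero_pow]; positivity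

/-- Jensen over the step weights reduces to a single step. The scale `16κ` is twice the critical
value `8κ`, and `κ / (16κ - 8κ) = 1/8`. -/
theorem lintegral_eexp_squareFunctional_le (hE : 1 ≤ E) {κ : ℝ} (hκ : 0 < κ) (w : Vec d)
    {N : Ω → Fin (E + 1) → Vec d} (hNm : ∀ τ, Measurable (fun ω => N ω τ))
    (hN : ∀ τ, SubG κ (fun ω => N ω τ) μ) :
    ∫⁻ ω, eexp (squareFunctional (16 * κ) w (N ω)) ∂μ ≤ eexp (1 / 8) := by
  have hm : ∀ τ, Measurable fun ω => eexp (‖N ω τ‖ ^ 2 / (16 * κ)) := fun τ =>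
    measurable_eexp.comp (((hNm τ).norm.pow_const 2).div_const _)
  have hle : ∀ ω, eexp (squareFunctional (16 * κ) w (N ω)) ≤
      ∑ τ, ENNReal.ofReal (stepWeight τ) * eexp (‖N ω τ‖ ^ 2 / (16 * κ)) := fun ω =>
    eexp_sum_le Finset.univ stepWeight _ (fun τ _ => stepWeight_nonneg τ) (sum_stepWeight hE)
  refine (lintegral_mono hle).trans ?_
  rw [lintegral_finsetSum _ (fun τ _ => (hm τ).const_mul _)]
  have hle2 : ∀ τ ∈ Finset.univ, ∫⁻ ω, ENNReal.ofReal (stepWeight τ) *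
      eexp (‖N ω τ‖ ^ 2 / (16 * κ)) ∂μ ≤ ENNReal.ofReal (stepWeight τ) * eexp (1 / 8) := by
    intro τ _
    rw [lintegral_const_mul _ (hm τ)]
    refine mul_le_mul_right ?_ _
    have := (hN τ).2 0 (16 * κ) (by linarith)
    simp only [zero_add, norm_zero] at this
    refine this.trans (eexp_mono (le_of_eq ?_))
    have : 16 * κ - 8 * κ = 8 * κ := by ring
    rw [this]; field_simp; ring
  refine (Finset.sum_le_sum hle2).trans (le_of_eq ?_)
  rw [← Finset.sum_mul, ← ENNReal.ofReal_sum_of_nonneg (fun τ _ => stepWeight_nonneg τ),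
    sum_stepWeight hE]
  simp

end Functional

/-! ### The exceptional event -/

/-- Outside an event of probability at most `δ`, all batch errors of function values are small,
and so are the linear and the quadratic contribution of the gradient noise. -/
theorem exists_exceptional_event {n d Bv Bg K E : ℕ} [NeZero n]
    (hBv : 1 ≤ Bv) (hBg : 1 ≤ Bg) (hK : 1 ≤ K) (hE : 1 ≤ E)
    {Z : Type*} [MeasurableSpace Z] {p : Problem n d Z}
    (hdist : ∀ i, IsProbabilityMeasure (p.dist i)) (hmeas : p.IsMeasurable)
    {Θ : Set (Vec d)} (hΘ : MeasurableSet Θ)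
    {D σv σg δ : ℝ} (hσv : 0 < σv) (hσg : 0 < σg) (hδ : 0 < δ) (hδ' : δ < 1)
    (hsubf : SubGaussianEstimates p.dist Θ σv p.f)
    (hsubg : SubGaussianEstimates p.dist Θ σv p.g)
    (hsubgradf : SubGaussianGradients p.dist Θ σg p.f p.gradf)
    (hsubgradg : SubGaussianGradients p.dist Θ σg p.g p.gradg)
    {y : Vec d} (hy : ∀ w ∈ Θ, ‖y - w‖ ≤ D) (w₀ : Vec d) (a : Params) (haE : a.E = E)
    {Ω : Type*} [MeasurableSpace Ω] {μ : Measure Ω} [IsProbabilityMeasure μ]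
    {X : Ω → Samples n Bv Bg Z} (hX : IsSampling μ p K E X) {c : ℝ}
    (hc : K * (E * (σg ^ 2 / Bg) * (c ^ 2 * D ^ 2)) = Real.log (8 / δ)) :
    ∃ A : Set Ω, μ A ≤ ENNReal.ofReal δ ∧ ∀ ω ∉ A,
      (∀ k < K, ∀ i,
        |noise Θ (p.f i) (p.dist i) (globalIter p a w₀ (X ω) k) ((X ω).ξ k i)|
          ≤ 2 * σv * √(2 * Real.log (12 * K * n / δ) / Bv) ∧
        |noise Θ (p.g i) (p.dist i) (globalIter p a w₀ (X ω) k) ((X ω).ξ k i)|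
          ≤ 2 * σv * √(2 * Real.log (12 * K * n / δ) / Bv)) ∧
      ∑ k ∈ Finset.range K, roundValue p a Θ (linearFunctional (E := E) Θ c y)
        (globalIter p a w₀ (X ω) k) ((X ω).ξ k) ((X ω).ζ k) ≤ 2 * Real.log (8 / δ) ∧
      ∑ k ∈ Finset.range K, roundValue p a Θ
        (squareFunctional (E := E) (16 * (E * (σg ^ 2 / Bg))))
        (globalIter p a w₀ (X ω) k) ((X ω).ξ k) ((X ω).ζ k) ≤ K / 8 + Real.log (8 / δ) := by
  have hBg0 : (0 : ℝ) < Bg := by exact_mod_cast hBg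
  have hBv0 : (0 : ℝ) < Bv := by exact_mod_cast hBv
  have hE0 : (0 : ℝ) < E := by exact_mod_cast hE
  have hK0 : (0 : ℝ) < K := by exact_mod_cast hK
  have hn0 : (0 : ℝ) < n := by exact_mod_cast Nat.pos_of_ne_zero (NeZero.ne n)
  have hn1 : (1 : ℝ) ≤ n := by exact_mod_cast Nat.one_le_iff_ne_zero.2 (NeZero.ne n)
  have hK1 : (1 : ℝ) ≤ K := by exact_mod_cast hK
  have hκ : 0 < E * (σg ^ 2 / Bg) := by positivity
  set ℓ := Real.log (8 / δ) with hℓ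
  set x : ℝ := 12 * K * n / δ with hx
  have hx0 : 0 < x := by positivity
  have hx1 : 1 ≤ x := by
    rw [hx, le_div_iff₀ hδ]
    nlinarith [mul_le_mul hK1 hn1 zero_le_one hK0.le]
  have hlog : 0 ≤ Real.log x := Real.log_nonneg hx1
  set e : ℝ := 2 * σv * √(2 * Real.log x / Bv) with he
  set W : ℕ → Ω → Vec d := fun k ω => globalIter p a w₀ (X ω) k with hW
  set Y : (Fin n → Vec d → Z → ℝ) → ℕ → Fin n → Ω → ℝ := fun h k i ω =>
    noise Θ (h i) (p.dist i) (W k ω) ((X ω).ξ k i) with hY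
  set M : Ω → ℝ := fun ω => ∑ k ∈ Finset.range K,
    roundValue p a Θ (linearFunctional (E := E) Θ c y) (W k ω) ((X ω).ξ k) ((X ω).ζ k) with hM
  set Q : Ω → ℝ := fun ω => ∑ k ∈ Finset.range K,
    roundValue p a Θ (squareFunctional (E := E) (16 * (E * (σg ^ 2 / Bg)))) (W k ω) ((X ω).ξ k)
      ((X ω).ζ k) with hQ
  have hWm : ∀ k ≤ K, Measurable (W k) := fun k hk =>
    (measurable_globalIter_past (X := X) hmeas a haE w₀ le_rfl hk).mono
      (sigmaOf_le hX.measurable_sampleVar) le_rfl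
  have hroundm : ∀ Φ : Vec d → (Fin (E + 1) → Vec d) → ℝ,
      Measurable (fun q : Vec d × (Fin (E + 1) → Vec d) => Φ q.1 q.2) →
      Measurable (fun ω => ∑ k ∈ Finset.range K,
        roundValue p a Θ Φ (W k ω) ((X ω).ξ k) ((X ω).ζ k)) := by
    intro Φ hΦ
    refine Finset.measurable_sum _ fun k hk => ?_
    have hk := Finset.mem_range.1 hk
    exact measurable_roundValue hmeas a (hWm k hk.le) (Ξ := fun ω => (X ω).ξ k)
      (fun i s => (hX.1 k hk i s).1) hdist hΘ (ζ := fun ω => (X ω).ζ k)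
      (fun i t ht s => (hX.2.1 k hk i t ht s).1) hΦ
  have hMQ : eexp (-ℓ) = ENNReal.ofReal (δ / 8) := by
    rw [eexp, hℓ, Real.exp_neg, Real.exp_log (by positivity), inv_div]
  -- The normalization of `c` gives `E exp M ≤ exp ℓ`, so the level `2ℓ` is exceeded with
  -- probability at most `exp (-ℓ) = δ/8`.
  have hPM : μ {ω | 2 * ℓ ≤ M ω} ≤ ENNReal.ofReal (δ / 8) := by
    have h := lintegral_eexp_sum_roundValue_le hBg hmeas hdist hΘ hσg hsubgradf hsubgradg a haE hX
      (measurable_linearFunctional hΘ c y) (C := E * (σg ^ 2 / Bg) * (c ^ 2 * D ^ 2))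
      (fun w N _ hN => lintegral_eexp_linearFunctional_le hy hκ.le c w hN) w₀ K le_rfl
    rw [hc] at h
    refine (measure_ge_le_eexp h (hroundm _ (measurable_linearFunctional hΘ c y)) _).trans ?_
    rw [← hMQ]; exact eexp_mono (by linarith)
  have hPQ : μ {ω | K / 8 + ℓ ≤ Q ω} ≤ ENNReal.ofReal (δ / 8) := by
    have h := lintegral_eexp_sum_roundValue_le hBg hmeas hdist hΘ hσg hsubgradf hsubgradg a haE hX
      (measurable_squareFunctional (16 * (E * (σg ^ 2 / Bg)))) (C := 1 / 8)
      (fun w N hNm hN => lintegral_eexp_squareFunctional_le hE hκ w hNm hN) w₀ K le_rfl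
    refine (measure_ge_le_eexp h (hroundm _ (measurable_squareFunctional _)) _).trans ?_
    rw [← hMQ]; exact eexp_mono (by linarith)
  have hPY : ∀ h : Fin n → Vec d → Z → ℝ,
      (∀ i, Measurable (fun x : Vec d × Z => h i x.1 x.2)) →
      SubGaussianEstimates p.dist Θ σv h → ∀ k < K, ∀ i,
      μ {ω | e ≤ |Y h k i ω|} ≤ ENNReal.ofReal (δ / (6 * K * n)) := by
    intro h hh hsub k hk i
    obtain ⟨hm, hs⟩ := subG_noise_globalIter hBv hmeas hdist hΘ hσv a haE hX w₀ hh hsub hk i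
    refine (hs.measure_abs_ge_le (by positivity) hm (by positivity)).trans ?_
    have h1 : e ^ 2 / (4 * (σv ^ 2 / Bv)) = 2 * Real.log x := by
      rw [he, mul_pow, Real.sq_sqrt (by positivity)]
      field_simp; ring
    -- The tail at this threshold is `x⁻²`; since `x ≥ 1`, it may be weakened to `x⁻¹ = δ / (12 K
    -- n)`, which is all that the union bound needs.
    have h2 : eexp (-(e ^ 2 / (4 * (σv ^ 2 / Bv)))) ≤ ENNReal.ofReal (δ / (12 * K * n)) := by
      rw [h1]
      refine (eexp_mono (y := - Real.log x) (by linarith)).trans (le_of_eq ?_)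
      rw [eexp, Real.exp_neg, Real.exp_log hx0, hx, inv_div]
    refine (mul_le_mul_right h2 2).trans (le_of_eq ?_)
    have h3 : (2 : ENNReal) = ENNReal.ofReal 2 := by simp
    rw [h3, ← ENNReal.ofReal_mul (by norm_num)]
    congr 1
    field_simp; norm_num
  have hPU : ∀ h : Fin n → Vec d → Z → ℝ,
      (∀ i, Measurable (fun x : Vec d × Z => h i x.1 x.2)) →
      SubGaussianEstimates p.dist Θ σv h →
      μ (⋃ j ∈ Finset.range K ×ˢ (Finset.univ : Finset (Fin n)), {ω | e ≤ |Y h j.1 j.2 ω|})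
        ≤ ENNReal.ofReal (δ / 6) := by
    intro h hh hsub
    refine (measure_biUnion_finset_le _ _).trans ?_
    refine (Finset.sum_le_sum fun j hj => hPY h hh hsub j.1
      (Finset.mem_range.1 (Finset.mem_product.1 hj).1) j.2).trans (le_of_eq ?_)
    rw [Finset.sum_const, Finset.card_product, Finset.card_range, Finset.card_univ,
      Fintype.card_fin, nsmul_eq_mul, ← ENNReal.ofReal_natCast,
      ← ENNReal.ofReal_mul (Nat.cast_nonneg _)]
    congr 1
    push_cast
    field_simp
  refine ⟨((⋃ j ∈ Finset.range K ×ˢ (Finset.univ : Finset (Fin n)), {ω | e ≤ |Y p.f j.1 j.2 ω|}) ∪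
    (⋃ j ∈ Finset.range K ×ˢ (Finset.univ : Finset (Fin n)), {ω | e ≤ |Y p.g j.1 j.2 ω|})) ∪
    ({ω | 2 * ℓ ≤ M ω} ∪ {ω | K / 8 + ℓ ≤ Q ω}), ?_, ?_⟩
  -- The four bad events use `7δ/12` of the available `δ`.
  · calc _ ≤ (ENNReal.ofReal (δ / 6) + ENNReal.ofReal (δ / 6)) +
          (ENNReal.ofReal (δ / 8) + ENNReal.ofReal (δ / 8)) :=
        (measure_union_le _ _).trans (add_le_add
          ((measure_union_le _ _).trans (add_le_add (hPU p.f (fun i => (hmeas i).1) hsubf)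
            (hPU p.g (fun i => (hmeas i).2.1) hsubg)))
          ((measure_union_le _ _).trans (add_le_add hPM hPQ)))
      _ = ENNReal.ofReal ((δ / 6 + δ / 6) + (δ / 8 + δ / 8)) := by
        rw [ENNReal.ofReal_add (by positivity) (by positivity),
          ENNReal.ofReal_add (by positivity) (by positivity),
          ENNReal.ofReal_add (by positivity) (by positivity)]
      _ ≤ ENNReal.ofReal δ := ENNReal.ofReal_le_ofReal (by linarith)
  · intro ω hω
    simp only [Set.mem_union, Set.mem_iUnion, Set.mem_ofPred_eq, not_or, not_exists, not_le,
      Finset.mem_product, Finset.mem_range, Finset.mem_univ, and_true] at hω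
    obtain ⟨⟨hf, hg⟩, hM', hQ'⟩ := hω
    exact ⟨fun k hk i => ⟨(hf (k, i) hk).le, (hg (k, i) hk).le⟩, hM'.le, hQ'.le⟩

/-! ### Softmax is a soft maximum -/

/-- The softmax average is within `log n / α` of the maximum. -/
theorem le_softmax_sum_add_log {n : ℕ} [NeZero n] (v : Fin n → ℝ) (i : Fin n) :
    v i ≤ ∑ j, softmax v j * v j + Real.log n := by
  set S := ∑ j, Real.exp (v j) with hS
  have hS0 : 0 < S := sum_exp_pos v
  have hn0 : (0 : ℝ) < n := by exact_mod_cast Nat.pos_of_ne_zero (NeZero.ne n)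
  have h1 : v i ≤ Real.log S := by
    rw [Real.le_log_iff_exp_le hS0]
    exact Finset.single_le_sum (f := fun j => Real.exp (v j)) (fun j _ => (Real.exp_pos _).le)
      (Finset.mem_univ i)
  -- Since `log S - v j = -log (softmax v j)`, the sum over `j` says that the entropy of the softmax
  -- weights is at most `log n`. Each term is `log x ≤ x - 1` at `x = 1 / (n * softmax v j)`.
  have h2 : ∀ j, softmax v j * (Real.log S - v j - Real.log n) ≤ 1 / n - softmax v j := by
    intro j
    have hq := softmax_pos v j
    have hlog : Real.log (1 / (n * softmax v j)) = Real.log S - v j - Real.log n := by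
      have : 1 / (n * softmax v j) = S / (Real.exp (v j) * n) := by
        unfold softmax; rw [← hS]; field_simp
      rw [this, Real.log_div hS0.ne' (by positivity), Real.log_mul (Real.exp_pos _).ne' hn0.ne',
        Real.log_exp]
      ring
    have := Real.log_le_sub_one_of_pos (x := 1 / (n * softmax v j)) (by positivity)
    rw [hlog] at this
    calc _ ≤ softmax v j * (1 / (n * softmax v j) - 1) := mul_le_mul_of_nonneg_left this hq.le
      _ = _ := by field_simp
  have h3 := Finset.sum_le_sum fun j (_ : j ∈ Finset.univ) => h2 j
  simp only [mul_sub, Finset.sum_sub_distrib, ← Finset.sum_mul, sum_softmax, Finset.sum_const,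
    Finset.card_univ, Fintype.card_fin, nsmul_eq_mul] at h3
  rw [mul_one_div_cancel hn0.ne'] at h3
  linarith

/-- Rescaling by `α` turns the error `log n` into `log n / α`. For `n = 1` the parameter may vanish,
but then the softmax average is the only value. -/
theorem le_softmax_sum {n : ℕ} [NeZero n] {α ε : ℝ} (hε : 0 < ε) (hα : 2 * Real.log n / ε ≤ α)
    (v : Fin n → ℝ) (i : Fin n) : v i ≤ ∑ j, softmax (α • v) j * v j + ε / 2 := by
  have hn1 : (1 : ℝ) ≤ n := by exact_mod_cast Nat.one_le_iff_ne_zero.2 (NeZero.ne n)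
  rcases eq_or_lt_of_le hn1 with h | h
  · have hn : n = 1 := by exact_mod_cast h.symm
    have hs : ∀ j, v j = v i := fun j => by
      congr 1; apply Fin.ext; omega
    simp only [hs]
    rw [← Finset.sum_mul, sum_softmax]; linarith
  · have hlog := Real.log_pos h
    have hα0 : 0 < α := lt_of_lt_of_le (by positivity) hα
    have h1 := le_softmax_sum_add_log (α • v) i
    have e : ∑ j, softmax (α • v) j * (α • v) j = α * ∑ j, softmax (α • v) j * v j := by
      rw [Finset.mul_sum]
      exact Finset.sum_congr rfl fun j _ => by simp only [Pi.smul_apply, smul_eq_mul]; ring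
    rw [e, Pi.smul_apply, smul_eq_mul] at h1
    rw [div_le_iff₀ hε] at hα
    nlinarith

/-! ### One round of the algorithm -/

/-- A subgradient on `Θ` at an interior point of an `L`-Lipschitz function has norm at most `L`. -/
theorem norm_subgradient_le {d : ℕ} {Θ : Set (Vec d)} {L : ℝ} (hL : 0 ≤ L) {h : Vec d → ℝ}
    {w v : Vec d} (hlip : ∀ w₁ ∈ Θ, ∀ w₂ ∈ Θ, |h w₁ - h w₂| ≤ L * ‖w₁ - w₂‖) (hw : w ∈ interior Θ)
    (hv : IsSubgradientOn Θ h w v) : ‖v‖ ≤ L := by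
  rcases eq_or_ne v 0 with h0 | h0
  · simpa [h0] using hL
  obtain ⟨r, hr, hball⟩ := Metric.mem_nhds_iff.1 (mem_interior_iff_mem_nhds.1 hw)
  have hv0 : 0 < ‖v‖ := norm_pos_iff.2 h0
  -- Test the subgradient at `w + t v`, at distance `r / 2` from `w`: `t ‖v‖² ≤ h(w + t v) - h(w) ≤
  -- L t ‖v‖`.
  set t := r / (2 * ‖v‖) with ht
  have ht0 : 0 < t := by positivity
  have hnorm : ‖t • v‖ = t * ‖v‖ := by rw [norm_smul, Real.norm_of_nonneg ht0.le]
  have hmem : w + t • v ∈ Θ := by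
    apply hball
    rw [Metric.mem_ball, dist_self_add_left, hnorm, ht]
    field_simp; linarith
  have h1 := hv _ hmem
  have h2 := (abs_le.1 (hlip _ hmem w (interior_subset hw))).2
  rw [add_sub_cancel_left, inner_smul_right, real_inner_self_eq_norm_sq] at h1
  rw [add_sub_cancel_left, hnorm] at h2
  have h3 : (t * ‖v‖) * ‖v‖ ≤ (t * ‖v‖) * L := by nlinarith
  exact le_of_mul_le_mul_left h3 (by positivity)

/-! ### The local steps of a single client. -/

section Client

variable {d B : ℕ} {Z : Type*} [MeasurableSpace Z] {Θ : Set (Vec d)} {v : Vec d → Z → Vec d}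
  {P : Measure Z} {γ : ℝ} {w : Vec d} {x : ℕ → Fin B → Z}

/-- On a path inside `Θ` the cut-off is inactive, so each batch gradient is its mean plus `noise`,
and the steps add up. -/
theorem sub_localIter_eq (τ : ℕ) (hmem : ∀ t < τ, localIter v γ w x t ∈ Θ) :
    w - localIter v γ w x τ
      = γ • (∑ t ∈ Finset.range τ, ∫ z, v (localIter v γ w x t) z ∂P
        + noiseSum Θ v P γ w x τ) := by
  induction τ with
  | zero => simp [localIter, noiseSum]
  | succ τ ih =>
    have h := ih fun t ht => hmem t (ht.trans τ.lt_succ_self)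
    have hτ := hmem τ τ.lt_succ_self
    have e : w - localIter v γ w x (τ + 1) = (w - localIter v γ w x τ)
        + γ • batchMean v (localIter v γ w x τ) (x τ) := by
      simp only [localIter]; abel
    rw [e, h, ← smul_add]
    congr 1
    simp only [noiseSum, Finset.sum_range_succ, noise, hτ, if_true]
    abel

variable {L : ℝ} {h : Vec d → ℝ} {E : ℕ}

theorem norm_sub_localIter_le (hγ : 0 ≤ γ) (hbd : ∀ w ∈ Θ, ‖∫ z, v w z ∂P‖ ≤ L) (τ : ℕ)
    (hmem : ∀ t < τ, localIter v γ w x t ∈ Θ) :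
    ‖w - localIter v γ w x τ‖ ≤ γ * (τ * L + ‖noiseSum Θ v P γ w x τ‖) := by
  rw [sub_localIter_eq τ hmem, norm_smul, Real.norm_of_nonneg hγ]
  refine mul_le_mul_of_nonneg_left ((norm_add_le _ _).trans ?_) hγ
  gcongr
  refine (norm_sum_le_of_le _ fun t ht => hbd _ (hmem t (Finset.mem_range.1 ht))).trans ?_
  simp

/-- The update direction of a client is the average of the gradients at the local points plus the
averaged noise. -/
theorem clientDirection_eq (hγ : 0 < γ) (hmem : ∀ t < E, localIter v γ w x t ∈ Θ) :
    (γ * E)⁻¹ • (w - localIter v γ w x E)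
      = (E : ℝ)⁻¹ • (∑ t ∈ Finset.range E, ∫ z, v (localIter v γ w x t) z ∂P
        + noiseSum Θ v P γ w x E) := by
  rw [sub_localIter_eq E hmem, smul_smul]
  congr 1
  rw [mul_inv, mul_assoc, mul_comm, mul_assoc, mul_inv_cancel₀ hγ.ne', mul_one]

theorem norm_sq_clientDirection_le (hE : 1 ≤ E) (hγ : 0 < γ)
    (hbd : ∀ w ∈ Θ, ‖∫ z, v w z ∂P‖ ≤ L) (hmem : ∀ t < E, localIter v γ w x t ∈ Θ) :
    ‖(γ * E)⁻¹ • (w - localIter v γ w x E)‖ ^ 2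
      ≤ 2 * L ^ 2 + 2 * (‖noiseSum Θ v P γ w x E‖ ^ 2 / E ^ 2) := by
  have hE0 : (0 : ℝ) < E := by exact_mod_cast hE
  have h := norm_sub_localIter_le (P := P) hγ.le hbd E hmem
  have h1 : ‖(γ * E)⁻¹ • (w - localIter v γ w x E)‖ ≤ L + ‖noiseSum Θ v P γ w x E‖ / E := by
    rw [norm_smul, Real.norm_of_nonneg (by positivity), inv_mul_le_iff₀ (by positivity)]
    refine h.trans (le_of_eq ?_)
    field_simp
  have h2 : ‖(γ * E)⁻¹ • (w - localIter v γ w x E)‖ ^ 2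
      ≤ (L + ‖noiseSum Θ v P γ w x E‖ / E) ^ 2 := by gcongr
  rw [← div_pow]
  nlinarith [sq_nonneg (L - ‖noiseSum Θ v P γ w x E‖ / E)]

/-- Progress of one client towards a point `y`. -/
theorem le_inner_clientDirection (hE : 1 ≤ E) (hγ : 0 < γ) (hL : 0 ≤ L)
    (hlip : ∀ w₁ ∈ Θ, ∀ w₂ ∈ Θ, |h w₁ - h w₂| ≤ L * ‖w₁ - w₂‖)
    (hsub : ∀ w ∈ Θ, IsSubgradientOn Θ h w (∫ z, v w z ∂P))
    (hbd : ∀ w ∈ Θ, ‖∫ z, v w z ∂P‖ ≤ L) (hmem : ∀ t < E, localIter v γ w x t ∈ Θ)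
    {y : Vec d} (hy : y ∈ Θ) {ρ : ℝ} (hρ : 0 < ρ) :
    h w - h y - (γ * E * L ^ 2 + γ * E * L * ρ + γ * E * L / ρ *
        ((∑ τ ∈ Finset.range E, ‖noiseSum Θ v P γ w x τ‖ ^ 2 / E ^ 2) / E))
      - inner ℝ (noiseSum Θ v P γ w x E) ((E : ℝ)⁻¹ • (y - w))
      ≤ inner ℝ ((γ * E)⁻¹ • (w - localIter v γ w x E)) (w - y) := by
  have hE0 : (0 : ℝ) < E := by exact_mod_cast hE
  have hw : w ∈ Θ := hmem 0 hE
  -- The subgradient lives at the local point `u`, not at `w`. Splitting `w - y = (w - u) - (y - u)`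
  -- and comparing `h u` with `h w` each cost `L ‖w - u‖`, and the drift satisfies `‖w - u‖ ≤ γ (τ L
  -- + N)`.
  have hstep : ∀ τ ∈ Finset.range E, h w - h y - γ * L * (2 * τ * L + E * ρ +
      E / ρ * (‖noiseSum Θ v P γ w x τ‖ ^ 2 / E ^ 2))
      ≤ inner ℝ (∫ z, v (localIter v γ w x τ) z ∂P) (w - y) := by
    intro τ hτ
    have hτ' := Finset.mem_range.1 hτ
    set u := localIter v γ w x τ with hu
    set N := ‖noiseSum Θ v P γ w x τ‖ with hN
    have hmu : u ∈ Θ := hmem τ hτ'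
    have h1 := hsub u hmu y hy
    have h2 := (abs_le.1 (hlip w hw u hmu)).2
    have h3 := norm_sub_localIter_le (P := P) hγ.le hbd τ fun t ht => hmem t (ht.trans hτ')
    rw [← hu, ← hN] at h3
    have h4 : inner ℝ (∫ z, v u z ∂P) (w - y)
        = inner ℝ (∫ z, v u z ∂P) (w - u) - inner ℝ (∫ z, v u z ∂P) (y - u) := by
      rw [← inner_sub_right]; congr 1; abel
    have h5 : -(L * ‖w - u‖) ≤ inner ℝ (∫ z, v u z ∂P) (w - u) := by
      have := (abs_le.1 (abs_real_inner_le_norm (∫ z, v u z ∂P) (w - u))).1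
      have h6 := mul_le_mul_of_nonneg_right (hbd u hmu) (norm_nonneg (w - u))
      linarith
    have h7 : L * ‖w - u‖ ≤ L * (γ * (τ * L + N)) := mul_le_mul_of_nonneg_left h3 hL
    -- Young's inequality replaces the norm of the noise by its square, for which exponential
    -- moments are available; `ρ` stays free until the rounds are summed.
    have h8 : 2 * N ≤ E * ρ + E / ρ * (N ^ 2 / E ^ 2) := by
      have e : E * ρ + E / ρ * (N ^ 2 / E ^ 2) - 2 * N = (E * ρ - N) ^ 2 / (E * ρ) := by
        field_simp; ring
      have : 0 ≤ (E * ρ - N) ^ 2 / (E * ρ) := by positivity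
      linarith
    have h9 : γ * L * (2 * N) ≤ γ * L * (E * ρ + E / ρ * (N ^ 2 / E ^ 2)) :=
      mul_le_mul_of_nonneg_left h8 (by positivity)
    rw [h4]
    nlinarith
  have hsum := Finset.sum_le_sum hstep
  rw [clientDirection_eq (P := P) hγ hmem, real_inner_smul_left, inner_add_left, sum_inner,
    real_inner_smul_right]
  have hgauss : (∑ τ ∈ Finset.range E, (τ : ℝ)) * 2 ≤ E * E := by
    have := Finset.sum_range_id_mul_two E
    have h2 : ((∑ τ ∈ Finset.range E, τ) * 2 : ℕ) ≤ E * E := by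
      rw [this]; exact Nat.mul_le_mul_left _ (Nat.sub_le _ _)
    have h3 : (((∑ τ ∈ Finset.range E, τ) * 2 : ℕ) : ℝ) ≤ ((E * E : ℕ) : ℝ) := Nat.cast_le.2 h2
    push_cast at h3
    exact h3
  set S₂ := ∑ τ ∈ Finset.range E, ‖noiseSum Θ v P γ w x τ‖ ^ 2 / (E : ℝ) ^ 2 with hS₂
  set S₁ := ∑ τ ∈ Finset.range E, (τ : ℝ) with hS₁
  have hlhs : ∑ τ ∈ Finset.range E, (h w - h y - γ * L * (2 * τ * L + E * ρ +
      E / ρ * (‖noiseSum Θ v P γ w x τ‖ ^ 2 / E ^ 2)))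
      = E * (h w - h y) - γ * L * (2 * L * S₁ + E * (E * ρ) + E / ρ * S₂) := by
    rw [Finset.sum_sub_distrib, ← Finset.mul_sum, Finset.sum_add_distrib, Finset.sum_add_distrib,
      ← Finset.mul_sum, hS₁, hS₂, Finset.mul_sum (a := 2 * L),
      ← Finset.mul_sum]
    simp only [Finset.sum_const, Finset.card_range, nsmul_eq_mul]
    congr 4
    exact Finset.sum_congr rfl fun τ _ => by ring
  rw [hlhs] at hsum
  have hflip : inner ℝ (noiseSum Θ v P γ w x E) (y - w)
      = - inner ℝ (noiseSum Θ v P γ w x E) (w - y) := by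
    rw [← inner_neg_right, neg_sub]
  rw [hflip, mul_add]
  have hγL : 0 ≤ γ * L * L := by positivity
  have hS₁' : γ * L * (2 * L * S₁) ≤ γ * L * L * (E * E) := by nlinarith
  have key : E * (h w - h y - (γ * E * L ^ 2 + γ * E * L * ρ + γ * E * L / ρ * (S₂ / E)))
      ≤ ∑ τ ∈ Finset.range E, inner ℝ (∫ z, v (localIter v γ w x τ) z ∂P) (w - y) := by
    refine le_trans ?_ hsum
    have e : (E : ℝ) * (γ * E * L / ρ * (S₂ / E)) = γ * L * (E / ρ * S₂) := by
      field_simp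
    nlinarith
  have key2 := mul_le_mul_of_nonneg_left key (inv_nonneg.2 hE0.le)
  rw [inv_mul_cancel_left₀ hE0.ne'] at key2
  linarith

end Client

/-! ### Averaging over the clients and the progress of one global round. -/

section Round

variable {n d Bv Bg : ℕ} {Z : Type*} [MeasurableSpace Z] {p : Problem n d Z}
  {Θ : Set (Vec d)} {a : Params}

open Classical in
/-- The function which client `i` minimizes in a round. -/
noncomputable def activeMean (p : Problem n d Z) (a : Params) (w : Vec d)
    (ξ : Fin n → Fin Bv → Z) (i : Fin n) : Vec d → ℝ :=
  if Accepts p a w ξ then mean p.dist p.f i else mean p.dist p.g i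

/-- The weighted average of a client quantity. -/
noncomputable def clientAverage (p : Problem n d Z) (a : Params) (w : Vec d)
    (ξ : Fin n → Fin Bv → Z) (x : Fin n → ℝ) : ℝ :=
  ∑ i, activeWeight p a w ξ i * x i

theorem clientAverage_add (w : Vec d) (ξ : Fin n → Fin Bv → Z) (x y : Fin n → ℝ) :
    clientAverage p a w ξ (fun i => x i + y i)
      = clientAverage p a w ξ x + clientAverage p a w ξ y := by
  simp only [clientAverage, mul_add, Finset.sum_add_distrib]

theorem clientAverage_const_mul (w : Vec d) (ξ : Fin n → Fin Bv → Z) (c : ℝ) (x : Fin n → ℝ) :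
    clientAverage p a w ξ (fun i => c * x i) = c * clientAverage p a w ξ x := by
  simp only [clientAverage, Finset.mul_sum]
  exact Finset.sum_congr rfl fun i _ => by ring

theorem roundValue_linearFunctional {E : ℕ} (hE : 1 ≤ E) {w : Vec d} (hw : w ∈ Θ) (y : Vec d)
    (c : ℝ) (ξ : Fin n → Fin Bv → Z) (ζ : Fin n → ℕ → Fin Bg → Z) :
    roundValue p a Θ (linearFunctional (E := E) Θ c y) w ξ ζ
      = c * E * clientAverage p a w ξ (fun i =>
          inner ℝ (roundNoise p a Θ w ξ ζ i E) ((E : ℝ)⁻¹ • (y - w))) := by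
  have hE0 : (E : ℝ) ≠ 0 := by positivity
  rw [← clientAverage_const_mul, roundValue, clientAverage]
  refine Finset.sum_congr rfl fun i _ => ?_
  simp only [linearFunctional, hw, if_true, Fin.val_last]
  rw [real_inner_smul_left, real_inner_smul_right, real_inner_comm]
  field_simp

/-- Two squared noises enter the progress of a round: the average along the local path, from the
drift, and the final one, from the squared step length. The step weights are chosen so that one
functional controls both. -/
theorem roundValue_squareFunctional {E : ℕ} (hE : 1 ≤ E) (w : Vec d) (c : ℝ)
    (ξ : Fin n → Fin Bv → Z) (ζ : Fin n → ℕ → Fin Bg → Z) :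
    roundValue p a Θ (squareFunctional (E := E) c) w ξ ζ
      = E ^ 2 / (2 * c) * (clientAverage p a w ξ (fun i =>
            (∑ τ ∈ Finset.range E, ‖roundNoise p a Θ w ξ ζ i τ‖ ^ 2 / E ^ 2) / E)
          + clientAverage p a w ξ (fun i => ‖roundNoise p a Θ w ξ ζ i E‖ ^ 2 / E ^ 2)) := by
  have hE0 : (E : ℝ) ≠ 0 := by positivity
  rw [← clientAverage_add, ← clientAverage_const_mul, roundValue, clientAverage]
  refine Finset.sum_congr rfl fun i _ => ?_
  congr 1
  have := sum_stepWeight_mul (E := E) (fun τ => ‖roundNoise p a Θ w ξ ζ i τ‖ ^ 2 / c)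
  simp only [squareFunctional]
  rw [this, ← Finset.sum_div, ← Finset.sum_div]
  field_simp

variable [NeZero n]

theorem clientAverage_const (w : Vec d) (ξ : Fin n → Fin Bv → Z) (c : ℝ) :
    clientAverage p a w ξ (fun _ => c) = c := by
  rw [clientAverage, ← Finset.sum_mul, sum_activeWeight, one_mul]

theorem clientAverage_mono (w : Vec d) (ξ : Fin n → Fin Bv → Z) {x y : Fin n → ℝ}
    (h : ∀ i, x i ≤ y i) : clientAverage p a w ξ x ≤ clientAverage p a w ξ y :=
  Finset.sum_le_sum fun i _ => mul_le_mul_of_nonneg_left (h i) (activeWeight_nonneg p a w ξ i)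

/-- The progress of one round towards a point `y`. -/
theorem round_progress {L : ℝ} (hL : 0 < L) (hE : 1 ≤ a.E) (hη : 0 < a.η) (hγ : 0 < a.γ)
    (hγη : a.γ * a.E = a.η)
    (hlipf : IsLipschitzFamily Θ L (mean p.dist p.f))
    (hlipg : IsLipschitzFamily Θ L (mean p.dist p.g))
    (hsubf : ∀ i, ∀ w ∈ Θ, IsSubgradientOn Θ (mean p.dist p.f i) w (mean p.dist p.gradf i w))
    (hsubg : ∀ i, ∀ w ∈ Θ, IsSubgradientOn Θ (mean p.dist p.g i) w (mean p.dist p.gradg i w))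
    (hbdf : IsBoundedOffInterior Θ L (mean p.dist p.gradf))
    (hbdg : IsBoundedOffInterior Θ L (mean p.dist p.gradg))
    {w y : Vec d} (hy : y ∈ Θ) {ξ : Fin n → Fin Bv → Z} {ζ : Fin n → ℕ → Fin Bg → Z}
    (hmem : ∀ i, ∀ τ < a.E, localPoint p a w ξ ζ i τ ∈ Θ) {ρ : ℝ} (hρ : 0 < ρ) :
    2 * a.η * clientAverage p a w ξ (fun i => activeMean p a w ξ i w - activeMean p a w ξ i y)
      ≤ ‖w - y‖ ^ 2
        - ‖w - a.η • ∑ i, activeWeight p a w ξ i • localDirection p a w ξ ζ i - y‖ ^ 2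
        + 2 * a.η * (2 * a.η * L ^ 2 + a.η * L * ρ
          + a.η * L / ρ * clientAverage p a w ξ (fun i =>
            (∑ τ ∈ Finset.range a.E, ‖roundNoise p a Θ w ξ ζ i τ‖ ^ 2 / a.E ^ 2) / a.E)
          + a.η * clientAverage p a w ξ (fun i => ‖roundNoise p a Θ w ξ ζ i a.E‖ ^ 2 / a.E ^ 2)
          + clientAverage p a w ξ (fun i =>
            inner ℝ (roundNoise p a Θ w ξ ζ i a.E) ((a.E : ℝ)⁻¹ • (y - w)))) := by
  set A : Fin n → ℝ := fun i => ‖roundNoise p a Θ w ξ ζ i a.E‖ ^ 2 / a.E ^ 2 with hA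
  set B : Fin n → ℝ := fun i =>
    (∑ τ ∈ Finset.range a.E, ‖roundNoise p a Θ w ξ ζ i τ‖ ^ 2 / a.E ^ 2) / a.E with hB
  set I : Fin n → ℝ := fun i =>
    inner ℝ (roundNoise p a Θ w ξ ζ i a.E) ((a.E : ℝ)⁻¹ • (y - w)) with hI
  set dir : Fin n → Vec d := fun i => localDirection p a w ξ ζ i with hdir
  set gap : Fin n → ℝ := fun i => activeMean p a w ξ i w - activeMean p a w ξ i y with hgap
  have hclient : ∀ i, ‖dir i‖ ^ 2 ≤ 2 * L ^ 2 + 2 * A i ∧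
      gap i - (a.η * L ^ 2 + a.η * L * ρ + a.η * L / ρ * B i) - I i
        ≤ inner ℝ (dir i) (w - y) := by
    intro i
    have hmain : ∀ (h : Vec d → ℝ) (v : Vec d → Z → Vec d),
        activeMean p a w ξ i = h → activeGrad p a w ξ i = v →
        (∀ w₁ ∈ Θ, ∀ w₂ ∈ Θ, |h w₁ - h w₂| ≤ L * ‖w₁ - w₂‖) →
        (∀ w ∈ Θ, IsSubgradientOn Θ h w (∫ z, v w z ∂(p.dist i))) →
        (∀ w ∈ Θ \ interior Θ, ‖∫ z, v w z ∂(p.dist i)‖ ≤ L) →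
        ‖dir i‖ ^ 2 ≤ 2 * L ^ 2 + 2 * A i ∧
        gap i - (a.η * L ^ 2 + a.η * L * ρ + a.η * L / ρ * B i) - I i
          ≤ inner ℝ (dir i) (w - y) := by
      intro h v hh hv hlip hsub hbd
      -- The Lipschitz constant bounds subgradients at interior points; elsewhere the bound is the
      -- separate hypothesis.
      have hbd' : ∀ w ∈ Θ, ‖∫ z, v w z ∂(p.dist i)‖ ≤ L := by
        intro u hu
        by_cases hint : u ∈ interior Θ
        · exact norm_subgradient_le hL.le hlip hint (hsub u hu)
        · exact hbd u ⟨hu, hint⟩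
      have hmem' : ∀ t < a.E, localIter v a.γ w (ζ i) t ∈ Θ := fun t ht => by
        have := hmem i t ht
        unfold localPoint at this
        rwa [hv] at this
      have h1 := norm_sq_clientDirection_le (P := p.dist i) hE hγ hbd' hmem'
      have h2 := le_inner_clientDirection hE hγ hL.le hlip hsub hbd' hmem' hy hρ
      simp only [hγη] at h1 h2
      simp only [hgap, hA, hB, hI, hdir, localDirection, localPoint, roundNoise, hh, hv, localIter,
        hγη]
      exact ⟨h1, h2⟩
    by_cases hacc : Accepts p a w ξ
    · exact hmain (mean p.dist p.f i) (p.gradf i) (by simp [activeMean, hacc])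
        (by simp [activeGrad, hacc]) (hlipf i) (hsubf i) (hbdf i)
    · exact hmain (mean p.dist p.g i) (p.gradg i) (by simp [activeMean, hacc])
        (by simp [activeGrad, hacc]) (hlipg i) (hsubg i) (hbdg i)
  set r : Fin n → ℝ := fun i => activeWeight p a w ξ i with hr
  have hr0 : ∀ i, 0 ≤ r i := activeWeight_nonneg p a w ξ
  have hr1 : ∑ i, r i = 1 := sum_activeWeight p a w ξ
  have hnorm : ‖∑ i, r i • dir i‖ ^ 2 ≤ 2 * L ^ 2 + 2 * clientAverage p a w ξ A := by
    have hconv : ConvexOn ℝ Set.univ (fun x : Vec d => ‖x‖ ^ 2) :=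
      (convexOn_univ_norm).pow (fun _ _ => norm_nonneg _) 2
    have h := hconv.map_sum_le (t := Finset.univ) (w := r) (p := dir) (fun i _ => hr0 i) hr1
      (fun _ _ => Set.mem_univ _)
    refine h.trans ?_
    have h2 := clientAverage_mono (p := p) (a := a) w ξ fun i => (hclient i).1
    rw [clientAverage_add, clientAverage_const, clientAverage_const_mul] at h2
    exact h2
  have hinner : clientAverage p a w ξ gap - (a.η * L ^ 2 + a.η * L * ρ
      + a.η * L / ρ * clientAverage p a w ξ B) - clientAverage p a w ξ I
      ≤ inner ℝ (∑ i, r i • dir i) (w - y) := by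
    have h2 := clientAverage_mono (p := p) (a := a) w ξ
      (x := gap) (y := fun i => (((a.η * L ^ 2 + a.η * L * ρ) + a.η * L / ρ * B i) + I i)
        + inner ℝ (dir i) (w - y)) fun i => by linarith [(hclient i).2]
    rw [clientAverage_add, clientAverage_add, clientAverage_add, clientAverage_const,
      clientAverage_const_mul] at h2
    have e : inner ℝ (∑ i, r i • dir i) (w - y)
        = clientAverage p a w ξ (fun i => inner ℝ (dir i) (w - y)) := by
      rw [sum_inner]
      exact Finset.sum_congr rfl fun i _ => real_inner_smul_left _ _ _
    rw [e]; linarith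
  have hexp : ‖w - a.η • ∑ i, r i • dir i - y‖ ^ 2 = ‖w - y‖ ^ 2
      - 2 * a.η * inner ℝ (∑ i, r i • dir i) (w - y) + a.η ^ 2 * ‖∑ i, r i • dir i‖ ^ 2 := by
    have e : w - a.η • ∑ i, r i • dir i - y = (w - y) - a.η • ∑ i, r i • dir i := by abel
    rw [e, norm_sub_sq_real, norm_smul, mul_pow, Real.norm_eq_abs, sq_abs, real_inner_smul_right,
      real_inner_comm]
    ring
  -- The term `2 η L²` collects one `η L²` from the local drift and one from the squared step length
  -- divided by `2 η`.
  rw [hexp]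
  have h1 := mul_le_mul_of_nonneg_left hnorm (sq_nonneg a.η)
  have h2 := mul_le_mul_of_nonneg_left hinner (by positivity : 0 ≤ 2 * a.η)
  nlinarith

end Round

/-! ### The choice of the constants -/

/-- The left side is what telescoping leaves, with `T` the bound for the total squared noise and `b
= σ̄_g`; the right side is `K ε' / 2`. After substituting `η`, all terms are compared as multiples
of `D L s` with `s = √(8K)`. -/
theorem constants_bound {D L b ℓ : ℝ} {K E : ℕ} (hD : 0 < D) (hL : 0 < L) (hb : 0 < b)
    (hℓ : 1 ≤ ℓ) (hK : 1 ≤ K) {η T : ℝ} (hη : η = D / (L * √(8 * (K : ℝ))))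
    (hT : T = 32 * (L ^ 2 * b ^ 2) * (K / 8 + ℓ)) :
    D ^ 2 / (2 * η) + 2 * η * L ^ 2 * K + 2 * (η * L * √(K * T)) + η * T
        + 2 * D * L * b * √(ℓ * K)
      ≤ K * (D * L / √((K : ℝ) / 32) * (1 + 2 * b ^ 2 * (3 + 8 * ℓ / K)
        + b * √(8 * ℓ) * (1 + E / √(6 * (K : ℝ))))) / 2 := by
  have hK1 : (1 : ℝ) ≤ K := by exact_mod_cast hK
  have hK0 : (0 : ℝ) < K := by linarith
  have hℓ0 : 0 < ℓ := by linarith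
  set s := √(8 * (K : ℝ)) with hs
  have hs0 : 0 < s := Real.sqrt_pos.2 (by positivity)
  have hs2 : s ^ 2 = 8 * K := Real.sq_sqrt (by positivity)
  have hKs : (K : ℝ) = s ^ 2 / 8 := by linarith
  set q := √(8 : ℝ) with hq
  have hq2 : q ^ 2 = 8 := Real.sq_sqrt (by norm_num)
  -- A rational lower bound for `√8` is enough: the coefficient of `b m` on the left is `3/2 + 2/2.8
  -- < 2.8`.
  have hq28 : 2.8 ≤ q := Real.le_sqrt_of_sq_le (by norm_num)
  set m := √ℓ with hm
  have hm0 : 0 < m := Real.sqrt_pos.2 hℓ0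
  have hm2 : m ^ 2 = ℓ := Real.sq_sqrt hℓ0.le
  have e1 : √((K : ℝ) / 32) = s / 16 := by
    rw [Real.sqrt_eq_iff_mul_self_eq (by positivity) (by positivity)]
    nlinarith
  have e2 : √(8 * ℓ) = q * m := Real.sqrt_mul (by norm_num) _
  have e3 : √(K * T) ≤ 6 * K * L * b * m := by
    refine Real.sqrt_le_iff.2 ⟨by positivity, ?_⟩
    have : (6 * K * L * b * m) ^ 2 = L ^ 2 * b ^ 2 * (36 * K ^ 2 * ℓ) := by rw [← hm2]; ring
    rw [this, hT]
    have h1 : 4 * (K : ℝ) ^ 2 + 32 * K * ℓ ≤ 36 * K ^ 2 * ℓ := by nlinarith [mul_pos hK0 hℓ0]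
    have h2 := mul_le_mul_of_nonneg_left h1 (by positivity : 0 ≤ L ^ 2 * b ^ 2)
    nlinarith
  have e4 : √(ℓ * K) ≤ m * (s / 2.8) := by
    refine Real.sqrt_le_iff.2 ⟨by positivity, ?_⟩
    have : (m * (s / 2.8)) ^ 2 = ℓ * K * (8 / 2.8 ^ 2) := by
      rw [mul_pow, div_pow, hm2, hs2]; ring
    rw [this]
    have : 0 < ℓ * K := by positivity
    nlinarith
  have t1 : D ^ 2 / (2 * η) = D * L * s / 2 := by rw [hη]; field_simp
  have t2 : 2 * η * L ^ 2 * K = D * L * s / 4 := by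
    rw [hη, hKs]; field_simp; norm_num
  have t3 : 2 * (η * L * √(K * T)) ≤ D * L * s * (3 / 2 * (b * m)) := by
    have hηL : η * L = D / s := by rw [hη]; field_simp
    rw [hηL]
    refine (mul_le_mul_of_nonneg_left
      (mul_le_mul_of_nonneg_left e3 (by positivity : 0 ≤ D / s)) zero_le_two).trans (le_of_eq ?_)
    rw [hKs]; field_simp; norm_num
  have t4 : η * T = D * L * s * (b ^ 2 * (1 / 2 + 4 * ℓ / K)) := by
    rw [hη, hT, hKs]; field_simp; ring
  have t5 : 2 * D * L * b * √(ℓ * K) ≤ D * L * s * (2 / 2.8 * (b * m)) := by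
    refine (mul_le_mul_of_nonneg_left e4 (by positivity)).trans (le_of_eq ?_)
    field_simp
  have e5 : K * (D * L / (s / 16) * (1 + 2 * b ^ 2 * (3 + 8 * ℓ / K)
        + b * (q * m) * (1 + E / √(6 * (K : ℝ))))) / 2
      = D * L * s * (1 + 2 * b ^ 2 * (3 + 8 * ℓ / K)
        + b * (q * m) * (1 + E / √(6 * (K : ℝ)))) := by
    have : (K : ℝ) * (D * L / (s / 16)) / 2 = D * L * s := by
      rw [hKs]; field_simp; norm_num
    rw [← this]; ring
  rw [e1, e2, e5, t1, t2, t4]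
  have hDLs : 0 < D * L * s := by positivity
  have hE : 0 ≤ E / √(6 * (K : ℝ)) := by positivity
  have hbm : 0 < b * m := by positivity
  have hcmp : 1 / 2 + 1 / 4 + 3 / 2 * (b * m) + b ^ 2 * (1 / 2 + 4 * ℓ / K) + 2 / 2.8 * (b * m)
      ≤ 1 + 2 * b ^ 2 * (3 + 8 * ℓ / K) + b * (q * m) * (1 + E / √(6 * (K : ℝ))) := by
    have h1 : b * m * 2.8 ≤ b * (q * m) * (1 + E / √(6 * (K : ℝ))) := by
      calc b * m * 2.8 ≤ b * m * q := by gcongr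
        _ = b * (q * m) * 1 := by ring
        _ ≤ _ := by gcongr; linarith
    have h2 : b ^ 2 * (1 / 2 + 4 * ℓ / K) ≤ 2 * b ^ 2 * (3 + 8 * ℓ / K) := by
      have h : 0 ≤ b ^ 2 * (11 / 2 + 12 * (ℓ / K)) := by positivity
      have e : 2 * b ^ 2 * (3 + 8 * ℓ / K) - b ^ 2 * (1 / 2 + 4 * ℓ / K)
          = b ^ 2 * (11 / 2 + 12 * (ℓ / K)) := by ring
      linarith
    norm_num at h1 ⊢
    linarith
  refine le_trans ?_ (mul_le_mul_of_nonneg_left hcmp hDLs.le)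
  rw [mul_add, mul_add, mul_add, mul_add, ← mul_div_assoc, ← mul_div_assoc]
  linarith

theorem sum_weight_mul_sub_le {n : ℕ} {v h q : Fin n → ℝ} (hq0 : ∀ i, 0 ≤ q i)
    (hq1 : ∑ i, q i = 1) {e : ℝ} (he : ∀ i, |v i - h i| ≤ e) :
    ∑ i, q i * v i - e ≤ ∑ i, q i * h i := by
  have h1 : ∑ i, q i * (v i - e) ≤ ∑ i, q i * h i := Finset.sum_le_sum fun i _ =>
    mul_le_mul_of_nonneg_left (by linarith [(abs_le.1 (he i)).2]) (hq0 i)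
  simp only [mul_sub, Finset.sum_sub_distrib, ← Finset.sum_mul, hq1, one_mul] at h1
  exact h1

theorem sum_weight_mul_le {n : ℕ} {h q : Fin n → ℝ} (hq0 : ∀ i, 0 ≤ q i)
    (hq1 : ∑ i, q i = 1) {t : ℝ} (ht : ∀ i, h i ≤ t) : ∑ i, q i * h i ≤ t := by
  have h1 : ∑ i, q i * h i ≤ ∑ i, q i * t := Finset.sum_le_sum fun i _ =>
    mul_le_mul_of_nonneg_left (ht i) (hq0 i)
  rwa [← Finset.sum_mul, hq1, one_mul] at h1

/-! ### Consequences of the good event along one trajectory. -/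

section Deterministic

variable {n d Bv Bg : ℕ} [NeZero n] {Z : Type*} [MeasurableSpace Z] {p : Problem n d Z}
  {Θ : Set (Vec d)} {a : Params}

/-- The sum over the rounds of the weighted optimality gaps, on the event that the noise is
small. -/
theorem sum_gap_le {D L b ℓ : ℝ} {K : ℕ} (hD : 0 < D) (hL : 0 < L) (hb : 0 < b) (hℓ : 1 ≤ ℓ)
    (hK : 1 ≤ K) (hE : 1 ≤ a.E) (hη : a.η = D / (L * √(8 * (K : ℝ)))) (hγη : a.γ * a.E = a.η)
    (hlipf : IsLipschitzFamily Θ L (mean p.dist p.f))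
    (hlipg : IsLipschitzFamily Θ L (mean p.dist p.g))
    (hsubf : ∀ i, ∀ w ∈ Θ, IsSubgradientOn Θ (mean p.dist p.f i) w (mean p.dist p.gradf i w))
    (hsubg : ∀ i, ∀ w ∈ Θ, IsSubgradientOn Θ (mean p.dist p.g i) w (mean p.dist p.gradg i w))
    (hbdf : IsBoundedOffInterior Θ L (mean p.dist p.gradf))
    (hbdg : IsBoundedOffInterior Θ L (mean p.dist p.gradg))
    (hdiam : ∀ w₁ ∈ Θ, ∀ w₂ ∈ Θ, ‖w₁ - w₂‖ ≤ D)
    {y : Vec d} (hy : y ∈ Θ) {w₀ : Vec d} (hw₀ : w₀ ∈ Θ) {x : Samples n Bv Bg Z}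
    (hstay : StaysIn p a w₀ x K Θ) (hmem : ∀ k < K, globalIter p a w₀ x k ∈ Θ) {c : ℝ}
    (hc0 : 0 < c) (hc : K * (a.E ^ 2 * (L ^ 2 * b ^ 2) * (c ^ 2 * D ^ 2)) = ℓ)
    (hM : ∑ k ∈ Finset.range K, roundValue p a Θ (linearFunctional (E := a.E) Θ c y)
        (globalIter p a w₀ x k) (x.ξ k) (x.ζ k) ≤ 2 * ℓ)
    (hQ : ∑ k ∈ Finset.range K, roundValue p a Θ
        (squareFunctional (E := a.E) (16 * (a.E ^ 2 * (L ^ 2 * b ^ 2))))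
        (globalIter p a w₀ x k) (x.ξ k) (x.ζ k) ≤ K / 8 + ℓ) :
    ∑ k ∈ Finset.range K, clientAverage p a (globalIter p a w₀ x k) (x.ξ k) (fun i =>
        activeMean p a (globalIter p a w₀ x k) (x.ξ k) i (globalIter p a w₀ x k)
          - activeMean p a (globalIter p a w₀ x k) (x.ξ k) i y)
      ≤ K * (D * L / √((K : ℝ) / 32) * (1 + 2 * b ^ 2 * (3 + 8 * ℓ / K)
        + b * √(8 * ℓ) * (1 + a.E / √(6 * (K : ℝ))))) / 2 := by
  have hK0 : (0 : ℝ) < K := by exact_mod_cast hK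
  have hE0 : (0 : ℝ) < a.E := by exact_mod_cast hE
  have hη0 : 0 < a.η := by rw [hη]; positivity
  have hγ0 : 0 < a.γ := by
    by_contra h
    have := mul_nonpos_of_nonpos_of_nonneg (not_lt.1 h) hE0.le
    linarith
  set W : ℕ → Vec d := globalIter p a w₀ x with hW
  set gap : ℕ → ℝ := fun k => clientAverage p a (W k) (x.ξ k) (fun i =>
    activeMean p a (W k) (x.ξ k) i (W k) - activeMean p a (W k) (x.ξ k) i y) with hgap
  set A : ℕ → ℝ := fun k => clientAverage p a (W k) (x.ξ k) (fun i =>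
    ‖roundNoise p a Θ (W k) (x.ξ k) (x.ζ k) i a.E‖ ^ 2 / a.E ^ 2) with hA
  set B : ℕ → ℝ := fun k => clientAverage p a (W k) (x.ξ k) (fun i =>
    (∑ τ ∈ Finset.range a.E, ‖roundNoise p a Θ (W k) (x.ξ k) (x.ζ k) i τ‖ ^ 2 / a.E ^ 2) / a.E)
    with hB
  set I : ℕ → ℝ := fun k => clientAverage p a (W k) (x.ξ k) (fun i =>
    inner ℝ (roundNoise p a Θ (W k) (x.ξ k) (x.ζ k) i a.E) ((a.E : ℝ)⁻¹ • (y - W k))) with hI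
  have hAB : ∀ k, 0 ≤ A k ∧ 0 ≤ B k := fun k =>
    ⟨Finset.sum_nonneg fun i _ => mul_nonneg (activeWeight_nonneg p a _ _ i) (by positivity),
      Finset.sum_nonneg fun i _ => mul_nonneg (activeWeight_nonneg p a _ _ i) (by positivity)⟩
  set T := 32 * (L ^ 2 * b ^ 2) * (K / 8 + ℓ) with hT
  have hT0 : 0 < T := by positivity
  have hsumAB : ∑ k ∈ Finset.range K, B k + ∑ k ∈ Finset.range K, A k ≤ T := by
    have e : ∀ k ∈ Finset.range K, roundValue p a Θ
        (squareFunctional (E := a.E) (16 * (a.E ^ 2 * (L ^ 2 * b ^ 2)))) (W k) (x.ξ k) (x.ζ k)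
        = (32 * (L ^ 2 * b ^ 2))⁻¹ * (B k + A k) := fun k _ => by
      rw [roundValue_squareFunctional hE]
      congr 1
      field_simp; norm_num
    rw [Finset.sum_congr rfl e, ← Finset.mul_sum, Finset.sum_add_distrib,
      inv_mul_le_iff₀ (by positivity)] at hQ
    exact hQ
  have hsumA : ∑ k ∈ Finset.range K, A k ≤ T := by
    linarith [Finset.sum_nonneg fun k (_ : k ∈ Finset.range K) => (hAB k).2]
  have hsumB : ∑ k ∈ Finset.range K, B k ≤ T := by
    linarith [Finset.sum_nonneg fun k (_ : k ∈ Finset.range K) => (hAB k).1]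
  have hsumI : ∑ k ∈ Finset.range K, I k ≤ 2 * D * L * b * √(ℓ * K) := by
    have e : ∀ k ∈ Finset.range K, roundValue p a Θ (linearFunctional (E := a.E) Θ c y)
        (W k) (x.ξ k) (x.ζ k) = c * a.E * I k := fun k hk =>
      roundValue_linearFunctional hE (hmem k (Finset.mem_range.1 hk)) y c _ _
    rw [Finset.sum_congr rfl e, ← Finset.mul_sum] at hM
    -- The normalization of `c` makes `√(ℓ K)` proportional to `c`, which turns the tail level `2ℓ /
    -- (c E)` into `2 D L b √(ℓ K)`.
    have hs : √(ℓ * K) = K * (c * a.E) * (D * L * b) := by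
      rw [Real.sqrt_eq_iff_mul_self_eq (by positivity) (by positivity), ← hc]
      ring
    have hcE : 0 < c * a.E := by positivity
    refine le_of_mul_le_mul_left (hM.trans (le_of_eq ?_)) hcE
    rw [hs, ← hc]; ring
  -- This `ρ` balances the two halves of Young's inequality: summed over the rounds, each is at most
  -- `η L √(K T)`.
  set ρ := √(T / K) with hρ
  have hρ0 : 0 < ρ := Real.sqrt_pos.2 (by positivity)
  have hρ2 : ρ ^ 2 = T / K := Real.sq_sqrt (by positivity)
  have hTρ : T = K * ρ ^ 2 := by rw [hρ2]; field_simp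
  have hKT : √(K * T) = K * ρ := by
    rw [Real.sqrt_eq_iff_mul_self_eq (by positivity) (by positivity), hTρ]; ring
  have hround : ∀ k ∈ Finset.range K, 2 * a.η * gap k
      ≤ (‖W k - y‖ ^ 2 - ‖W (k + 1) - y‖ ^ 2) + 2 * a.η * (2 * a.η * L ^ 2 + a.η * L * ρ
        + a.η * L / ρ * B k + a.η * A k + I k) := fun k hk =>
    round_progress hL hE hη0 hγ0 hγη hlipf hlipg hsubf hsubg hbdf hbdg hy
      (hstay k (Finset.mem_range.1 hk)) hρ0
  have hsum := Finset.sum_le_sum hround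
  rw [← Finset.mul_sum, Finset.sum_add_distrib, ← Finset.mul_sum,
    Finset.sum_range_sub' (fun k => ‖W k - y‖ ^ 2), Finset.sum_add_distrib, Finset.sum_add_distrib,
    Finset.sum_add_distrib, Finset.sum_const, Finset.card_range, nsmul_eq_mul, ← Finset.mul_sum,
    ← Finset.mul_sum] at hsum
  have h0 : ‖W 0 - y‖ ^ 2 ≤ D ^ 2 := by
    have := hdiam w₀ hw₀ y hy
    have e : W 0 = w₀ := rfl
    rw [e]; gcongr
  have h1 : a.η * L / ρ * ∑ k ∈ Finset.range K, B k ≤ a.η * L * (K * ρ) := by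
    refine (mul_le_mul_of_nonneg_left hsumB (by positivity)).trans (le_of_eq ?_)
    rw [hTρ]; field_simp
  have h2 : a.η * ∑ k ∈ Finset.range K, A k ≤ a.η * T := mul_le_mul_of_nonneg_left hsumA hη0.le
  refine le_trans ?_ (constants_bound (E := a.E) hD hL hb hℓ hK hη hT)
  rw [hKT]
  have h3 : 2 * a.η * ∑ k ∈ Finset.range K, gap k ≤ D ^ 2 + 2 * a.η * (2 * a.η * L ^ 2 * K
      + 2 * (a.η * L * (K * ρ)) + a.η * T + 2 * D * L * b * √(ℓ * K)) := by
    refine hsum.trans (add_le_add ?_ (mul_le_mul_of_nonneg_left ?_ (by positivity)))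
    · linarith [sq_nonneg ‖W K - y‖]
    · linarith
  have h4 : ∑ k ∈ Finset.range K, gap k ≤ (D ^ 2 + 2 * a.η * (2 * a.η * L ^ 2 * K
      + 2 * (a.η * L * (K * ρ)) + a.η * T + 2 * D * L * b * √(ℓ * K))) / (2 * a.η) := by
    rw [le_div_iff₀ (by positivity)]; linarith
  refine h4.trans (le_of_eq ?_)
  field_simp
  ring

/-- The value of a batch error at a point of `Θ`. -/
theorem noise_eq_of_mem {V : Type*} [NormedAddCommGroup V] [NormedSpace ℝ V] {B : ℕ}
    {v : Vec d → Z → V} {P : Measure Z} {w : Vec d} (hw : w ∈ Θ) (x : Fin B → Z) :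
    noise Θ v P w x = batchMean v w x - ∫ z, v w z ∂P := by
  simp [noise, hw]

theorem worst_le {h : Fin n → Vec d → ℝ} {w : Vec d} {t : ℝ} (ht : ∀ i, h i w ≤ t) :
    worst h w ≤ t :=
  Finset.sup'_le _ _ fun i _ => ht i

theorem le_worst (h : Fin n → Vec d → ℝ) (w : Vec d) (i : Fin n) : h i w ≤ worst h w :=
  Finset.le_sup' (fun i => h i w) (Finset.mem_univ i)

/-- The weighted gap in a rejected round is large. -/
theorem lt_gap_of_not_accepts {w y : Vec d} {ξ : Fin n → Fin Bv → Z} {ε' e : ℝ}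
    (hε : a.ε = ε' + 2 * e) (hG : p.G y ≤ 0) (hest : ∀ i, |estG p w ξ i - mean p.dist p.g i w| ≤ e)
    (hacc : ¬ Accepts p a w ξ) :
    ε' / 2 < clientAverage p a w ξ
      (fun i => activeMean p a w ξ i w - activeMean p a w ξ i y) := by
  have hq0 : ∀ i, 0 ≤ softmax (a.α • estG p w ξ) i := fun i => (softmax_pos _ i).le
  have hq1 : ∑ i, softmax (a.α • estG p w ξ) i = 1 := sum_softmax _
  simp only [clientAverage, activeWeight, activeMean, hacc, if_false, mul_sub,
    Finset.sum_sub_distrib]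
  -- Rejection means an estimated average above `ε/2 = ε'/2 + e`; the estimation error removes
  -- exactly `e`.
  have h1 := sum_weight_mul_sub_le hq0 hq1 hest
  have h2 := sum_weight_mul_le hq0 hq1 (h := fun i => mean p.dist p.g i y)
    fun i => (le_worst (mean p.dist p.g) y i).trans hG
  have h3 := not_le.1 hacc
  linarith

/-- The weighted gap in an accepted round bounds the optimality gap of the objective. -/
theorem sub_le_gap_of_accepts {w y : Vec d} {ξ : Fin n → Fin Bv → Z} {ε' e : ℝ} (hε' : 0 < ε')
    (hα : 2 * Real.log n / ε' ≤ a.α) (hest : ∀ i, |estF p w ξ i - mean p.dist p.f i w| ≤ e)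
    (hacc : Accepts p a w ξ) (i : Fin n) :
    mean p.dist p.f i w - p.F y - ε' / 2 - 2 * e ≤ clientAverage p a w ξ
      (fun i => activeMean p a w ξ i w - activeMean p a w ξ i y) := by
  have hq0 : ∀ i, 0 ≤ softmax (a.α • estF p w ξ) i := fun i => (softmax_pos _ i).le
  have hq1 : ∑ i, softmax (a.α • estF p w ξ) i = 1 := sum_softmax _
  simp only [clientAverage, activeWeight, activeMean, hacc, if_true, mul_sub,
    Finset.sum_sub_distrib]
  have h1 := sum_weight_mul_sub_le hq0 hq1 hest
  have h2 := sum_weight_mul_le hq0 hq1 (h := fun i => mean p.dist p.f i y) (t := p.F y)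
    fun i => le_worst (mean p.dist p.f) y i
  -- The error `e` is paid twice: passing from `f_i(w)` to its estimate, and from the softmax
  -- average of the estimates back to that of the true values.
  have h3 := le_softmax_sum hε' hα (estF p w ξ) i
  have h4 := (abs_le.1 (hest i)).1
  linarith

/-- In an accepted round the constraint is nearly satisfied. -/
theorem constraint_le_of_accepts {w : Vec d} {ξ : Fin n → Fin Bv → Z} {ε' e : ℝ} (hε' : 0 < ε')
    (hε : a.ε = ε' + 2 * e)
    (hα : 2 * Real.log n / ε' ≤ a.α) (hest : ∀ i, |estG p w ξ i - mean p.dist p.g i w| ≤ e)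
    (hacc : Accepts p a w ξ) (i : Fin n) : mean p.dist p.g i w ≤ a.ε := by
  have h3 := le_softmax_sum hε' hα (estG p w ξ) i
  have h4 := (abs_le.1 (hest i)).1
  have h5 : ∑ i, softmax (a.α • estG p w ξ) i * estG p w ξ i ≤ a.ε / 2 := hacc
  linarith

/-- The guarantee for the output, given a bound for the sum of the weighted gaps. -/
theorem output_guarantee {K : ℕ} (hK : 1 ≤ K)
    (hconvf : ∀ i, ConvexOn ℝ Θ (mean p.dist p.f i))
    (hconvg : ∀ i, ConvexOn ℝ Θ (mean p.dist p.g i)) {ε' e : ℝ} (hε' : 0 < ε')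
    (hε : a.ε = ε' + 2 * e) (hα : 2 * Real.log n / ε' ≤ a.α) {y : Vec d} (hG : p.G y ≤ 0)
    {w₀ : Vec d} {x : Samples n Bv Bg Z} (hmem : ∀ k < K, globalIter p a w₀ x k ∈ Θ)
    (hestf : ∀ k < K, ∀ i, |estF p (globalIter p a w₀ x k) (x.ξ k) i
      - mean p.dist p.f i (globalIter p a w₀ x k)| ≤ e)
    (hestg : ∀ k < K, ∀ i, |estG p (globalIter p a w₀ x k) (x.ξ k) i
      - mean p.dist p.g i (globalIter p a w₀ x k)| ≤ e)
    (hgap : ∑ k ∈ Finset.range K, clientAverage p a (globalIter p a w₀ x k) (x.ξ k) (fun i =>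
        activeMean p a (globalIter p a w₀ x k) (x.ξ k) i (globalIter p a w₀ x k)
          - activeMean p a (globalIter p a w₀ x k) (x.ξ k) i y) ≤ K * ε' / 2) :
    (acceptedRounds p a w₀ x K).Nonempty ∧ output p a w₀ x K ∈ Θ ∧
      p.F (output p a w₀ x K) - p.F y ≤ a.ε ∧ p.G (output p a w₀ x K) ≤ a.ε := by
  classical
  set W : ℕ → Vec d := globalIter p a w₀ x with hW
  set gap : ℕ → ℝ := fun k => clientAverage p a (W k) (x.ξ k) (fun i =>
    activeMean p a (W k) (x.ξ k) i (W k) - activeMean p a (W k) (x.ξ k) i y) with hgapdef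
  set S := acceptedRounds p a w₀ x K with hS
  have hSsub : S ⊆ Finset.range K := Finset.filter_subset _ _
  have hSK : ∀ k ∈ S, k < K := fun k hk => Finset.mem_range.1 (hSsub hk)
  have hSacc : ∀ k ∈ S, Accepts p a (W k) (x.ξ k) := fun k hk => (Finset.mem_filter.1 hk).2
  have hrej : ∀ k ∈ Finset.range K \ S, ε' / 2 < gap k := by
    intro k hk
    obtain ⟨hk1, hk2⟩ := Finset.mem_sdiff.1 hk
    exact lt_gap_of_not_accepts hε hG (hestg k (Finset.mem_range.1 hk1)) fun h =>
      hk2 (Finset.mem_filter.2 ⟨hk1, h⟩)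
  have hne : S.Nonempty := by
    rw [Finset.nonempty_iff_ne_empty]
    intro h0
    rw [h0, Finset.sdiff_empty] at hrej
    -- If every round were rejected, the gaps would sum to more than `K ε' / 2`.
    have := Finset.sum_lt_sum_of_nonempty (Finset.nonempty_range_iff.2 (by omega)) hrej
    rw [Finset.sum_const, Finset.card_range, nsmul_eq_mul] at this
    linarith
  have hcard : (0 : ℝ) < S.card := by exact_mod_cast hne.card_pos
  have hw0 : ∀ k ∈ S, (0 : ℝ) ≤ (S.card : ℝ)⁻¹ := fun _ _ => by positivity
  have hw1 : ∑ _k ∈ S, (S.card : ℝ)⁻¹ = 1 := by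
    rw [Finset.sum_const, nsmul_eq_mul, mul_inv_cancel₀ hcard.ne']
  have hWS : ∀ k ∈ S, W k ∈ Θ := fun k hk => hmem k (hSK k hk)
  have hout : output p a w₀ x K = ∑ k ∈ S, (S.card : ℝ)⁻¹ • W k := by
    rw [output, Finset.smul_sum]
  have hmean : ∀ h : Vec d → ℝ, ConvexOn ℝ Θ h →
      h (output p a w₀ x K) ≤ (S.card : ℝ)⁻¹ * ∑ k ∈ S, h (W k) := by
    intro h hh
    rw [hout, Finset.mul_sum]
    exact hh.map_sum_le hw0 hw1 hWS
  have havg : ∀ (z : ℕ → ℝ) (t : ℝ), ∑ k ∈ S, z k ≤ S.card * t →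
      (S.card : ℝ)⁻¹ * ∑ k ∈ S, z k ≤ t := fun z t h => by
    rwa [inv_mul_le_iff₀ hcard]
  refine ⟨hne, ?_, ?_, ?_⟩
  · rw [hout]
    exact (hconvf 0).1.sum_mem hw0 hw1 hWS
  · rw [sub_le_iff_le_add]
    refine worst_le fun i => (hmean _ (hconvf i)).trans (havg _ _ ?_)
    have h1 : ∑ k ∈ S, (mean p.dist p.f i (W k) - p.F y - ε' / 2 - 2 * e) ≤ ∑ k ∈ S, gap k :=
      Finset.sum_le_sum fun k hk =>
        sub_le_gap_of_accepts hε' hα (hestf k (hSK k hk)) (hSacc k hk) i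
    have h2 : ∑ _k ∈ Finset.range K \ S, ε' / 2 ≤ ∑ k ∈ Finset.range K \ S, gap k :=
      Finset.sum_le_sum fun k hk => (hrej k hk).le
    have h3 := Finset.sum_sdiff hSsub (f := gap)
    -- Each rejected round uses up at least `ε'/2` of the total `K ε'/2`, so the accepted rounds
    -- share at most `|S| ε'/2`.
    have h4 : ∑ _k ∈ Finset.range K \ S, ε' / 2 + ∑ _k ∈ S, ε' / 2 = K * (ε' / 2) := by
      rw [Finset.sum_sdiff hSsub, Finset.sum_const, Finset.card_range, nsmul_eq_mul]
    simp only [Finset.sum_sub_distrib, Finset.sum_const, nsmul_eq_mul] at h1 h4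
    rw [hε]
    simp only [Finset.sum_const, nsmul_eq_mul] at h2
    linarith
  · refine worst_le fun i => (hmean _ (hconvg i)).trans (havg _ _ ?_)
    refine (Finset.sum_le_sum fun k hk =>
      constraint_le_of_accepts hε' hε hα (hestg k (hSK k hk)) (hSacc k hk) i).trans (le_of_eq ?_)
    rw [Finset.sum_const, nsmul_eq_mul]

end Deterministic

end SwitchingGradient

/-! ### Assembly of the main theorem. -/

open SwitchingGradient in
theorem mainTheorem2 {n d Bv Bg K E : ℕ} [NeZero n]
    (hBv : 1 ≤ Bv) (hBg : 1 ≤ Bg) (hK : 1 ≤ K) (hE : 1 ≤ E)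
    {Z : Type*} [MeasurableSpace Z] (p : Problem n d Z)
    (hdist : ∀ i, IsProbabilityMeasure (p.dist i)) (hmeas : p.IsMeasurable)
    (Θ : Set (Vec d)) (hΘ : MeasurableSet Θ)
    {D L σv σg δ : ℝ} (hD : 0 < D) (hL : 0 < L) (hσv : 0 < σv) (hσg : 0 < σg)
    (hδ : 0 < δ) (hδ' : δ < 1)
    -- convexity
    (hconvf : ∀ i, ConvexOn ℝ Θ (mean p.dist p.f i))
    (hconvg : ∀ i, ConvexOn ℝ Θ (mean p.dist p.g i))
    -- Lipschitz continuity
    (hlipf : IsLipschitzFamily Θ L (mean p.dist p.f))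
    (hlipg : IsLipschitzFamily Θ L (mean p.dist p.g))
    (hbdf : IsBoundedOffInterior Θ L (mean p.dist p.gradf))
    (hbdg : IsBoundedOffInterior Θ L (mean p.dist p.gradg))
    -- diameter
    (hdiam : ∀ w₁ ∈ Θ, ∀ w₂ ∈ Θ, ‖w₁ - w₂‖ ≤ D)
    -- sub-Gaussian estimates and gradients
    (hsubf : SubGaussianEstimates p.dist Θ σv p.f)
    (hsubg : SubGaussianEstimates p.dist Θ σv p.g)
    (hsubgradf : SubGaussianGradients p.dist Θ σg p.f p.gradf)
    (hsubgradg : SubGaussianGradients p.dist Θ σg p.g p.gradg)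
    -- optimal solution and initial point
    (wstar : Vec d) (hopt : p.IsOptimal Θ wstar) (w₀ : Vec d) (hw₀ : w₀ ∈ Θ)
    -- inputs of the algorithm
    (a : Params) (haE : a.E = E)
    (hη : a.η = D / (L * √(8 * (K : ℝ))))
    (hγ : a.γ = D / (L * E * √(8 * (K : ℝ))))
    (hε : a.ε = tolerance D L σg σv δ n K E Bv Bg)
    (hα : 2 * Real.log n / optError D L σg δ K E Bg ≤ a.α)
    -- the random samples
    {Ω : Type*} [MeasurableSpace Ω] (μ : Measure Ω) [IsProbabilityMeasure μ]
    (X : Ω → Samples n Bv Bg Z) (hX : IsSampling μ p K E X) :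
    1 - δ ≤ μ.real {ω | StaysIn p a w₀ (X ω) K Θ →
      (acceptedRounds p a w₀ (X ω) K).Nonempty ∧
      output p a w₀ (X ω) K ∈ Θ ∧
      p.F (output p a w₀ (X ω) K) - p.F wstar ≤ a.ε ∧
      p.G (output p a w₀ (X ω) K) ≤ a.ε} := by
  subst haE
  have hK0 : (0 : ℝ) < K := by exact_mod_cast hK
  have hE0 : (0 : ℝ) < a.E := by exact_mod_cast hE
  have hBg0 : (0 : ℝ) < Bg := by exact_mod_cast hBg
  set ℓ := Real.log (8 / δ) with hℓdef
  have hℓ : 1 ≤ ℓ := by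
    rw [hℓdef, Real.le_log_iff_exp_le (by positivity), le_div_iff₀ hδ]
    nlinarith [Real.exp_one_lt_d9, Real.exp_pos 1]
  set b := √(effVar σg L Bg a.E) with hbdef
  have heff : 0 < effVar σg L Bg a.E := by unfold effVar; positivity
  have hb : 0 < b := Real.sqrt_pos.2 heff
  have hb2 : b ^ 2 = effVar σg L Bg a.E := Real.sq_sqrt heff.le
  -- The sub-Gaussian constant of a full round, rewritten in terms of `b = σ̄_g`.
  have hκ : a.E * (σg ^ 2 / Bg) = a.E ^ 2 * (L ^ 2 * b ^ 2) := by
    rw [hb2, effVar]; field_simp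
  -- The Chernoff parameter of the linear functional, solved from the requirement that its total
  -- log-moment over `K` rounds be `ℓ`.
  set c := √(ℓ / (K * (a.E ^ 2 * (L ^ 2 * b ^ 2)))) / D with hcdef
  have hℓ0 : 0 < ℓ := by linarith
  have hc0 : 0 < c := div_pos (Real.sqrt_pos.2 (by positivity)) hD
  have hc : K * (a.E ^ 2 * (L ^ 2 * b ^ 2) * (c ^ 2 * D ^ 2)) = ℓ := by
    have h1 : c ^ 2 * D ^ 2 = ℓ / (K * (a.E ^ 2 * (L ^ 2 * b ^ 2))) := by
      rw [hcdef, div_pow, Real.sq_sqrt (by positivity), div_mul_cancel₀ _ (by positivity)]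
    rw [h1]
    field_simp
  obtain ⟨hwstar, hG, -⟩ := hopt
  obtain ⟨A, hA, hgood⟩ := exists_exceptional_event hBv hBg hK hE hdist hmeas hΘ hσv hσg hδ hδ'
    hsubf hsubg hsubgradf hsubgradg (fun w hw => hdiam wstar hwstar w hw) w₀ a rfl hX
    (c := c) (by rw [hκ]; exact hc)
  have hopt' : optError D L σg δ K a.E Bg = D * L / √((K : ℝ) / 32) *
      (1 + 2 * b ^ 2 * (3 + 8 * ℓ / K) + b * √(8 * ℓ) * (1 + a.E / √(6 * (K : ℝ)))) := by
    rw [optError, hb2]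
  have hε' : 0 < optError D L σg δ K a.E Bg := by rw [hopt']; positivity
  set S : Set Ω := {ω | StaysIn p a w₀ (X ω) K Θ →
      (acceptedRounds p a w₀ (X ω) K).Nonempty ∧
      output p a w₀ (X ω) K ∈ Θ ∧
      p.F (output p a w₀ (X ω) K) - p.F wstar ≤ a.ε ∧
      p.G (output p a w₀ (X ω) K) ≤ a.ε} with hS
  have hsub : Aᶜ ⊆ S := by
    intro ω hω hstay
    obtain ⟨hval, hM, hQ⟩ := hgood ω hω
    -- The global point `w_k` is the local point of client `0` at `τ = 0`.
    have hmem : ∀ k < K, globalIter p a w₀ (X ω) k ∈ Θ := fun k hk => hstay k hk 0 0 hE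
    rw [hκ] at hQ
    have hgap := sum_gap_le hD hL hb hℓ hK hE hη (by rw [hγ, hη]; field_simp) hlipf hlipg
      (fun i w hw => (hsubgradf i w hw).2.1) (fun i w hw => (hsubgradg i w hw).2.1) hbdf hbdg
      hdiam hwstar hw₀ hstay hmem hc0 hc hM hQ
    rw [← hopt'] at hgap
    refine output_guarantee hK hconvf hconvg hε'
      (e := 2 * σv * √(2 * Real.log (12 * K * n / δ) / Bv)) (by rw [hε, tolerance]; ring) hα hG hmem
      (fun k hk i => ?_) (fun k hk i => ?_) hgap
    · have := (hval k hk i).1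
      rwa [noise_eq_of_mem (hmem k hk)] at this
    · have := (hval k hk i).2
      rwa [noise_eq_of_mem (hmem k hk)] at this
  -- Subadditivity on `S ∪ A`, instead of passing to complements, avoids any measurability claim
  -- about `S`.
  have h1 : (1 : ENNReal) ≤ μ S + ENNReal.ofReal δ := by
    calc (1 : ENNReal) = μ Set.univ := measure_univ.symm
      _ ≤ μ (S ∪ A) := measure_mono fun ω _ => by
          by_cases h : ω ∈ A
          · exact Or.inr h
          · exact Or.inl (hsub h)
      _ ≤ μ S + μ A := measure_union_le _ _
      _ ≤ _ := by gcongr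
  have h2 := ENNReal.toReal_mono (ENNReal.add_ne_top.2 ⟨measure_ne_top μ S,
    ENNReal.ofReal_ne_top⟩) h1
  rw [ENNReal.toReal_add (measure_ne_top μ S) ENNReal.ofReal_ne_top, ENNReal.toReal_ofReal hδ.le,
    ENNReal.toReal_one] at h2
  change 1 - δ ≤ (μ S).toReal
  linarith
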